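/- Identify $\mathbb{R}^2$ with $\mathbb{C}$, put $(x_1,x_2)^\perp=(-x_2,x_1)$, and let $\mathbb{T}=\mathbb{R}/2\pi\mathbb{Z}$. Let $0<\delta\le 1$ and let $z,h:\mathbb{R}\to\mathbb{R}^2$ be curves of class $C^{2,\delta}$ with $z(\alpha+2\pi)=z(\alpha)+(2\pi,0)$ and $h(\alpha+2\pi)=h(\alpha)+(2\pi,0)$. Write $$\|z\|_{C^{2,\delta}}=\sup_{|\alpha|\le\pi}|z(\alpha)|+\sup_{\alpha}|\partial_\alpha z(\alpha)|+\sup_\alpha|\partial_\alpha^2z(\alpha)|+\sup_{\alpha\ne\beta}\frac{|\partial_\alpha^2z(\alpha)-\partial_\alpha^2z(\beta)|}{|\alpha-\beta|^\delta},$$ $$\mathcal F(z)(\alpha,\beta)=\frac{\beta^2}{|z(\alpha)-z(\alpha-\beta)|^2}\ (\beta\ne0),\qquad \mathcal F(z)(\alpha,0)=\frac1{|\partial_\alpha z(\alpha)|^2},\qquad d(z,h)(\alpha,\beta)=\frac1{|z(\alpha)-h(\beta)|^2},$$ with $L^\infty$ norms taken over $(\alpha,\beta)\in\mathbb{R}^2$,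 and similarly for $h$. For curves $x,y$ and a $2\pi$-periodic function $u$ let $$T^*_{x,y}(u)(\alpha)=-\frac1\pi\,PV\!\int_{\mathbb{R}}\frac{(x(\alpha)-y(\beta))^\perp\cdot\partial_\alpha y(\beta)}{|x(\alpha)-y(\beta)|^2}\,u(\beta)\,d\beta,$$ where $PV\int_{\mathbb R}=\lim_{\varepsilon\to0^+,\,R\to\infty}\int_{\varepsilon<|\alpha-\beta|<R}$, and let $$\mathcal T^*(u_1,u_2)=\big(T^*_{z,z}u_1+T^*_{z,h}u_2,\ T^*_{h,z}u_1+T^*_{h,h}u_2\big).$$ Suppose that $\|\mathcal F(z)\|_{L^\infty}<\infty$, $\|\mathcal F(h)\|_{L^\infty}<\infty$ and $\|d(z,h)\|_{L^\infty}<\infty$. Then for all $u_1,u_2\in L^2(\mathbb{T})$ the four principal values exist at every $\alpha$, $\mathcal T^*$ maps $L^2(\mathbb T)\times L^2(\mathbb T)$ into $H^1(\mathbb T)\times H^1(\mathbb T)$, and $$\|\mathcal T^*\|_{L^2\times L^2\to H^1\times H^1}\le C_h\,\|\mathcal F(z)\|_{L^\infty}^2\,\max\big(1,\|d(z,h)\|_{L^\infty}\big)^2\,\|z\|_{C^{2,\delta}}^2,\qquad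 C_h=C\,\|\mathcal F(h)\|_{L^\infty}^2\|h\|_{C^{2,\delta}}^2,$$ where the constant $C$ depends only on $\delta$, and the norm of a pair is the sum of the norms of its components. -/

import Mathlib

open MeasureTheory Filter Topology Set
open scoped ENNReal NNReal ContDiff Real

noncomputable section

namespace Muskat

/-! The plane `ℝ²` is identified with `ℂ`: the Euclidean norm is `‖·‖`, the dot product is
`inner ℝ`, and `(x₁, x₂)^⊥ = (-x₂, x₁)` is multiplication by `I`. -/

/-- Lebesgue measure on one period; it represents the measure on the circle `𝕋 = ℝ/2πℤ`. -/
def circleMeasure : Measure ℝ := volume.restrict (Ioc (-π) π)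

/-- A parametrized curve that is `2π`-periodic in the horizontal direction:
`z (α + 2π) = z α + (2π, 0)`. -/
def IsPeriodicCurve (z : ℝ → ℂ) : Prop :=
  ∀ α : ℝ, z (α + 2 * π) = z α + ((2 * π : ℝ) : ℂ)

/-- The norm `‖z‖_{C^{2,δ}}` of a periodic curve. Only the zeroth order term is not a periodic
function of the parameter; its supremum is taken over one period. -/
def holderNorm (δ : ℝ) (z : ℝ → ℂ) : ℝ≥0∞ :=
  (⨆ α ∈ Icc (-π) π, ‖z α‖ₑ) + (⨆ α : ℝ, ‖deriv z α‖ₑ) + (⨆ α : ℝ, ‖deriv (deriv z) α‖ₑ)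
    + ⨆ (α : ℝ) (β : ℝ), ‖deriv (deriv z) α - deriv (deriv z) β‖ₑ / ‖α - β‖ₑ ^ δ

/-- `z ∈ C^{2,δ}`. -/
def IsC2Holder (δ : ℝ) (z : ℝ → ℂ) : Prop :=
  ContDiff ℝ 2 z ∧ holderNorm δ z < ⊤

/-- The arc-chord function `F(z)(α, β) = β² / |z(α) - z(α - β)|²`, extended to `β = 0` by
`1 / |∂z(α)|²`; it takes the value `∞` where the denominator vanishes. -/
def arcChord (z : ℝ → ℂ) (α β : ℝ) : ℝ≥0∞ :=
  if β = 0 then 1 / ‖deriv z α‖ₑ ^ 2 else ‖β‖ₑ ^ 2 / ‖z α - z (α - β)‖ₑ ^ 2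

/-- `‖F(z)‖_{L^∞}`. -/
def arcChordNorm (z : ℝ → ℂ) : ℝ≥0∞ := ⨆ (α : ℝ) (β : ℝ), arcChord z α β

/-- `‖d(z,h)‖_{L^∞}` where `d(z,h)(α, β) = 1 / |z(α) - h(β)|²`. -/
def distNorm (z h : ℝ → ℂ) : ℝ≥0∞ := ⨆ (α : ℝ) (β : ℝ), 1 / ‖z α - h β‖ₑ ^ 2

/-- The set `{β : ε < |α - β| < R}` over which a principal value at `α` is truncated. -/
def pvSet (α ε R : ℝ) : Set ℝ := {β : ℝ | ε < |α - β| ∧ |α - β| < R}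

/-- `v` is the principal value (at `β = α` and at infinity) of `∫_ℝ g(β) dβ`. -/
def HasPV (g : ℝ → ℝ) (α v : ℝ) : Prop :=
  (∀ ε R : ℝ, 0 < ε → IntegrableOn g (pvSet α ε R)) ∧
    Tendsto (fun p : ℝ × ℝ => ∫ β in pvSet α p.1 p.2, g β) (𝓝[>] 0 ×ˢ atTop) (𝓝 v)

/-- The principal value of `∫_ℝ g(β) dβ`; meaningful when `HasPV g α v` for some `v`. -/
def pv (g : ℝ → ℝ) (α : ℝ) : ℝ :=
  limUnder (𝓝[>] 0 ×ˢ atTop) (fun p : ℝ × ℝ => ∫ β in pvSet α p.1 p.2, g β)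

/-- The integrand `(x(α) - y(β))^⊥ · ∂y(β) / |x(α) - y(β)|² u(β)`. -/
def adjIntegrand (x y : ℝ → ℂ) (u : ℝ → ℝ) (α β : ℝ) : ℝ :=
  inner ℝ (Complex.I * (x α - y β)) (deriv y β) / ‖x α - y β‖ ^ 2 * u β

/-- `-(1/π) PV ∫_ℝ (x(α) - y(β))^⊥ · ∂y(β) / |x(α) - y(β)|² u(β) dβ`. The four entries are
`T₁* = adjEntry z z`, `T₂* = adjEntry h z`, `T₃* = adjEntry z h`, `T₄* = adjEntry h h`. -/
def adjEntry (x y : ℝ → ℂ) (u : ℝ → ℝ) (α : ℝ) : ℝ :=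
  -(1 / π) * pv (adjIntegrand x y u α) α

/-- First component `T₁* u₁ + T₃* u₂` of `𝒯*(u₁, u₂)`. -/
def adjFst (z h : ℝ → ℂ) (u₁ u₂ : ℝ → ℝ) (α : ℝ) : ℝ :=
  adjEntry z z u₁ α + adjEntry z h u₂ α

/-- Second component `T₂* u₁ + T₄* u₂` of `𝒯*(u₁, u₂)`. -/
def adjSnd (z h : ℝ → ℂ) (u₁ u₂ : ℝ → ℝ) (α : ℝ) : ℝ :=
  adjEntry h z u₁ α + adjEntry h h u₂ α

/-- `u ∈ L²(𝕋)`, as a `2π`-periodic function on `ℝ`. -/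
def MemL2 (u : ℝ → ℝ) : Prop :=
  Function.Periodic u (2 * π) ∧ MemLp u 2 circleMeasure

/-- `‖u‖_{L²(𝕋)}`. -/
def l2Norm (u : ℝ → ℝ) : ℝ≥0∞ := eLpNorm u 2 circleMeasure

/-- `g` is the weak derivative of `f` on `𝕋`. -/
def IsWeakDeriv (f g : ℝ → ℝ) : Prop :=
  ∀ φ : ℝ → ℝ, ContDiff ℝ ∞ φ → Function.Periodic φ (2 * π) →
    ∫ x, f x * deriv φ x ∂circleMeasure = -∫ x, g x * φ x ∂circleMeasure

/-- `f ∈ H¹(𝕋)`. -/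
def MemH1 (f : ℝ → ℝ) : Prop :=
  MemL2 f ∧ ∃ g : ℝ → ℝ, MemL2 g ∧ IsWeakDeriv f g

/-- `‖f‖_{H¹(𝕋)} = (‖f‖² + ‖∂f‖²)^{1/2}`, and `∞` if there is no weak derivative in `L²`. Weak
derivatives of `f` agree almost everywhere, so the infimum is over at most one value. -/
def h1Norm (f : ℝ → ℝ) : ℝ≥0∞ :=
  ⨅ (g : ℝ → ℝ) (_ : MemL2 g ∧ IsWeakDeriv f g), (l2Norm f ^ 2 + l2Norm g ^ 2) ^ (1 / 2 : ℝ)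

end Muskat

end

noncomputable section

namespace Muskat

/-! ### Periodic functions and integrals over one period -/

/-! In complex notation each entry has kernel `K(α, β) = Im (∂y(β) / (x(α) - y(β)))`. The gain of
one derivative comes from the imaginary part: for `x = y = z` and `s = α - β`, the singular part of
`∂z(β) / (z(α) - z(β))` is `1/s` and that of its `α`-derivative is `-1/s²`. Both are real and hence
invisible. What remains of `K` is bounded and has a limit on the diagonal. What remains of `∂_α K`
is `O(|s|^(δ-1))` near the diagonal, by a Taylor expansion with Hölder second derivative
(`norm_deriv_mul_deriv_sub_le`), and `O(1/s²)` far away, hence dominated by an integrable function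
of `s`. For two separated curves there is no singularity and only the decay matters.

At infinity `K` is only `Im ∂y(β) / s + O(1/s²)`. The non-integrable term is replaced by `Im ∂y(β) *
stepInv s`, where `stepInv` is an odd step function within `O(1/s²)` of `1/s` at infinity and
constant on each period away from the origin. Its symmetric truncations against any periodic
function tend to zero (`tendsto_integral_stepInv_convolution`). The principal value therefore exists
and equals the absolutely convergent integral of `(K - b * stepInv) * u`
(`IsSmoothingKernel.hasPV`).

Young's inequality for a kernel on the line and a function on the circle
(`lintegral_sq_convolution_le`) bounds this integral and `∫ K' u` in `L²`. That the latter is the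
weak derivative (`IsSmoothingKernel.isWeakDeriv`) follows by transposing the operators onto a test
function, through the exchange of period and line in `integral_unfold`, and integrating by parts in
`α`: the diagonal singularity is removable and `K` vanishes at infinity, so no boundary term
survives.

Every constant `M`, `N`, `F`, `G`, `D` that enters is at least `1`, so the four separate bounds are
all absorbed in the single product of squares. -/

instance : IsFiniteMeasure circleMeasure := by
  unfold circleMeasure; infer_instance

lemma Ioc_neg_pi_pi : Ioc (-π) π = Ioc (-π) (-π + 2 * π) := by
  congr 1; ring

/-- The group of diagonal translations of the plane by multiples of `2π`. -/
abbrev diagShifts : AddSubgroup (ℝ × ℝ) := AddSubgroup.zmultiples ((2 * π, 2 * π) : ℝ × ℝ)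

lemma isAddFundamentalDomain_diagShifts (s : Set (ℝ × ℝ)) (hs : MeasurableSet s)
    (h : ∀ x : ℝ × ℝ, ∃! n : ℤ, x + n • ((2 * π, 2 * π) : ℝ × ℝ) ∈ s) :
    IsAddFundamentalDomain diagShifts s (volume : Measure (ℝ × ℝ)) := by
  refine IsAddFundamentalDomain.mk' hs.nullMeasurableSet fun x => ?_
  have hinj : Function.Injective (fun n : ℤ => n • ((2 * π, 2 * π) : ℝ × ℝ)) := by
    intro m n hmn
    have := congrArg Prod.fst hmn
    simpa [Real.pi_ne_zero] using this
  have : Function.Bijective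
      (codRestrict (fun n : ℤ => n • ((2 * π, 2 * π) : ℝ × ℝ)) diagShifts _) :=
    (Equiv.ofInjective _ hinj).bijective
  refine this.existsUnique_iff.2 ?_
  simpa only [add_comm x] using! h x

/-- This strip and that of `isAddFundamentalDomain_strip_snd` are fundamental domains of one and the
same group, so an invariant function has equal integrals over both; this is how the period moves
from one variable to the other. -/
lemma isAddFundamentalDomain_strip_fst :
    IsAddFundamentalDomain diagShifts (Ioc (-π) π ×ˢ (univ : Set ℝ))
      (volume : Measure (ℝ × ℝ)) := by
  refine isAddFundamentalDomain_diagShifts _ (measurableSet_Ioc.prod .univ) fun x => ?_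
  have := existsUnique_add_zsmul_mem_Ioc Real.two_pi_pos x.1 (-π)
  rw [← Ioc_neg_pi_pi] at this
  simpa using this

lemma isAddFundamentalDomain_strip_snd :
    IsAddFundamentalDomain diagShifts ((univ : Set ℝ) ×ˢ Ioc (-π) π)
      (volume : Measure (ℝ × ℝ)) := by
  refine isAddFundamentalDomain_diagShifts _ (MeasurableSet.univ.prod measurableSet_Ioc) fun x => ?_
  have := existsUnique_add_zsmul_mem_Ioc Real.two_pi_pos x.2 (-π)
  rw [← Ioc_neg_pi_pi] at this
  simpa using this

lemma diagShifts_invariant {X : Type*} {H : ℝ × ℝ → X}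
    (hH : ∀ α β, H (α + 2 * π, β + 2 * π) = H (α, β)) (g : diagShifts) (x : ℝ × ℝ) :
    H (g +ᵥ x) = H x := by
  obtain ⟨g, n, rfl⟩ := g
  have hp : Function.Periodic H (2 * π, 2 * π) := fun y => hH y.1 y.2
  have := hp.zsmul n x
  rw [add_comm] at this
  exact this

lemma circleMeasure_prod_volume :
    circleMeasure.prod (volume : Measure ℝ) =
      (volume : Measure (ℝ × ℝ)).restrict (Ioc (-π) π ×ˢ univ) := by
  rw [Measure.volume_eq_prod, ← Measure.prod_restrict, Measure.restrict_univ]; rfl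

lemma volume_prod_circleMeasure :
    (volume : Measure ℝ).prod circleMeasure =
      (volume : Measure (ℝ × ℝ)).restrict (univ ×ˢ Ioc (-π) π) := by
  rw [Measure.volume_eq_prod, ← Measure.prod_restrict, Measure.restrict_univ]; rfl

/-- Unfolding: for a function invariant under diagonal shifts the roles of the two variables, one
running over a period and the other over the line, can be exchanged. -/
lemma lintegral_unfold {H : ℝ × ℝ → ℝ≥0∞}
    (hH : ∀ α β, H (α + 2 * π, β + 2 * π) = H (α, β)) :
    ∫⁻ p, H p ∂(circleMeasure.prod volume) = ∫⁻ p, H p ∂(volume.prod circleMeasure) := by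
  rw [circleMeasure_prod_volume, volume_prod_circleMeasure]
  exact isAddFundamentalDomain_strip_fst.setLIntegral_eq isAddFundamentalDomain_strip_snd _
    (diagShifts_invariant hH)

lemma integral_unfold {H : ℝ × ℝ → ℝ}
    (hH : ∀ α β, H (α + 2 * π, β + 2 * π) = H (α, β)) :
    ∫ p, H p ∂(circleMeasure.prod volume) = ∫ p, H p ∂(volume.prod circleMeasure) := by
  rw [circleMeasure_prod_volume, volume_prod_circleMeasure]
  exact isAddFundamentalDomain_strip_fst.setIntegral_eq isAddFundamentalDomain_strip_snd
    (diagShifts_invariant hH)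

lemma integrable_unfold {H : ℝ × ℝ → ℝ}
    (hH : ∀ α β, H (α + 2 * π, β + 2 * π) = H (α, β))
    (hi : Integrable H (circleMeasure.prod volume)) :
    Integrable H (volume.prod circleMeasure) := by
  rw [circleMeasure_prod_volume] at hi
  rw [volume_prod_circleMeasure]
  exact (isAddFundamentalDomain_strip_fst.integrableOn_iff isAddFundamentalDomain_strip_snd
    (diagShifts_invariant hH)).1 hi

lemma circleMeasure_absolutelyContinuous : circleMeasure ≪ (volume : Measure ℝ) :=
  Measure.absolutelyContinuous_of_le Measure.restrict_le_self

/-- Tonelli's theorem for the convolution of a function on the line with a periodic function. -/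
lemma lintegral_convolution {k w : ℝ → ℝ≥0∞} (hk : Measurable k) (hw : AEMeasurable w)
    (hper : Function.Periodic w (2 * π)) :
    ∫⁻ α, (∫⁻ β, k (α - β) * w β) ∂circleMeasure = (∫⁻ s, k s) * ∫⁻ β, w β ∂circleMeasure := by
  have hk2 : Measurable fun p : ℝ × ℝ => k (p.1 - p.2) :=
    hk.comp (measurable_fst.sub measurable_snd)
  have h1 : AEMeasurable (fun p : ℝ × ℝ => k (p.1 - p.2) * w p.2)
      (circleMeasure.prod volume) := hk2.aemeasurable.mul hw.comp_snd
  have h2 : AEMeasurable (fun p : ℝ × ℝ => k (p.1 - p.2) * w p.2)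
      (volume.prod circleMeasure) :=
    hk2.aemeasurable.mul (hw.mono_ac circleMeasure_absolutelyContinuous).comp_snd
  have h3 : ∫⁻ p, k (p.1 - p.2) * w p.2 ∂(circleMeasure.prod volume) =
      ∫⁻ p, k (p.1 - p.2) * w p.2 ∂((volume : Measure ℝ).prod circleMeasure) :=
    lintegral_unfold (H := fun p => k (p.1 - p.2) * w p.2) fun α β => by
      simp only [hper β, add_sub_add_right_eq_sub]
  rw [lintegral_prod _ h1, lintegral_prod_symm _ h2] at h3
  rw [h3, ← lintegral_const_mul'']
  · refine lintegral_congr fun β => ?_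
    dsimp only
    rw [lintegral_mul_const _ (by fun_prop), lintegral_sub_right_eq_self k β]
  · exact hw.mono_ac circleMeasure_absolutelyContinuous

/-- Young's inequality for the convolution of an integrable function on the line with a periodic
function. -/
lemma lintegral_sq_convolution_le {k w : ℝ → ℝ≥0∞} (hk : Measurable k) (hw : AEMeasurable w)
    (hper : Function.Periodic w (2 * π)) :
    ∫⁻ α, (∫⁻ β, k (α - β) * w β) ^ (2 : ℝ) ∂circleMeasure ≤
      (∫⁻ s, k s) ^ (2 : ℝ) * ∫⁻ β, w β ^ (2 : ℝ) ∂circleMeasure := by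
  -- Cauchy–Schwarz after writing `k = k^(1/2) * k^(1/2)` and leaving one half with `w`.
  have hCS : ∀ α, (∫⁻ β, k (α - β) * w β) ^ (2 : ℝ) ≤
      (∫⁻ s, k s) * ∫⁻ β, k (α - β) * w β ^ (2 : ℝ) := by
    intro α
    have hka : Measurable fun β => k (α - β) := by fun_prop
    have hs : ∀ x : ℝ≥0∞, (x ^ (1 / 2 : ℝ)) ^ (2 : ℝ) = x := fun x => by
      rw [← ENNReal.rpow_mul]; norm_num
    have h := ENNReal.lintegral_mul_le_Lp_mul_Lq volume Real.HolderConjugate.two_two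
      (f := fun β => k (α - β) ^ (1 / 2 : ℝ)) (g := fun β => k (α - β) ^ (1 / 2 : ℝ) * w β)
      (by fun_prop) (by fun_prop)
    have e1 : ∀ β, k (α - β) ^ (1 / 2 : ℝ) * (k (α - β) ^ (1 / 2 : ℝ) * w β) =
        k (α - β) * w β := fun β => by
      rw [← mul_assoc, ← ENNReal.rpow_add_of_nonneg _ _ (by norm_num) (by norm_num)]
      norm_num
    simp only [Pi.mul_apply, e1, hs, ENNReal.mul_rpow_of_nonneg _ _ zero_le_two] at h
    have h' := ENNReal.rpow_le_rpow h zero_le_two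
    rw [ENNReal.mul_rpow_of_nonneg _ _ zero_le_two, hs, hs, lintegral_sub_left_eq_self k α] at h'
    exact h'
  calc _ ≤ ∫⁻ α, (∫⁻ s, k s) * (∫⁻ β, k (α - β) * w β ^ (2 : ℝ)) ∂circleMeasure :=
        lintegral_mono hCS
    _ = (∫⁻ s, k s) * ∫⁻ α, (∫⁻ β, k (α - β) * w β ^ (2 : ℝ)) ∂circleMeasure := by
        refine lintegral_const_mul'' _ ?_
        have hk2 : Measurable fun p : ℝ × ℝ => k (p.1 - p.2) :=
          hk.comp (measurable_fst.sub measurable_snd)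
        exact (hk2.aemeasurable.mul
          (hw.pow_const (2 : ℝ)).comp_snd).lintegral_prod_right'
    _ = _ := by
        rw [lintegral_convolution hk (hw.pow_const _) fun x => by simp only [hper x],
          ← mul_assoc, ENNReal.rpow_two, sq]

lemma l2Norm_eq_lintegral (f : ℝ → ℝ) :
    l2Norm f = (∫⁻ x, ‖f x‖ₑ ^ (2 : ℝ) ∂circleMeasure) ^ (1 / 2 : ℝ) := by
  rw [l2Norm, eLpNorm_eq_lintegral_rpow_enorm_toReal (by norm_num) (by norm_num)]
  norm_num

/-- A function dominated by a convolution `k * |u|` has `L²` norm at most `‖k‖_{L¹} ‖u‖_{L²}`. -/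
lemma l2Norm_le_of_convolution {k : ℝ → ℝ≥0∞} {f u : ℝ → ℝ} (hk : Measurable k)
    (hu : AEStronglyMeasurable u) (hper : Function.Periodic u (2 * π))
    (hf : ∀ α, ‖f α‖ₑ ≤ ∫⁻ β, k (α - β) * ‖u β‖ₑ) :
    l2Norm f ≤ (∫⁻ s, k s) * l2Norm u := by
  rw [l2Norm_eq_lintegral, l2Norm_eq_lintegral]
  have h := lintegral_sq_convolution_le hk hu.enorm fun x => by simp only [hper x]
  calc _ ≤ ((∫⁻ s, k s) ^ (2 : ℝ) * ∫⁻ β, ‖u β‖ₑ ^ (2 : ℝ) ∂circleMeasure) ^ (1 / 2 : ℝ) := by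
        refine ENNReal.rpow_le_rpow (le_trans (lintegral_mono fun α => ?_) h) (by norm_num)
        exact ENNReal.rpow_le_rpow (hf α) zero_le_two
    _ = _ := by
        rw [ENNReal.mul_rpow_of_nonneg _ _ (by norm_num), ← ENNReal.rpow_mul]
        norm_num

/-- A periodic function integrable over one period is integrable over every bounded interval. -/
lemma intervalIntegrable_of_periodic {v : ℝ → ℝ} (hper : Function.Periodic v (2 * π))
    (hv : Integrable v circleMeasure) (a b : ℝ) : IntervalIntegrable v volume a b := by
  refine hper.intervalIntegrable (t := -π) Real.two_pi_pos.ne' ?_ a b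
  rw [intervalIntegrable_iff_integrableOn_Ioc_of_le (by linarith [Real.pi_pos]), ← Ioc_neg_pi_pi]
  exact hv

lemma locallyIntegrable_of_periodic {v : ℝ → ℝ} (hper : Function.Periodic v (2 * π))
    (hv : Integrable v circleMeasure) : LocallyIntegrable v := by
  rw [locallyIntegrable_iff]
  intro K hK
  obtain ⟨r, hr⟩ := hK.isBounded.subset_closedBall 0
  rw [Real.closedBall_eq_Icc] at hr
  by_cases h : (0:ℝ) - r ≤ 0 + r
  · exact ((intervalIntegrable_iff_integrableOn_Icc_of_le h).1
      (intervalIntegrable_of_periodic hper hv _ _)).mono_set hr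
  · rw [Icc_eq_empty h] at hr
    simp [subset_empty_iff.1 hr]

lemma MemL2.integrable {u : ℝ → ℝ} (hu : MemL2 u) : Integrable u circleMeasure :=
  hu.2.integrable (by norm_num)

lemma MemL2.aestronglyMeasurable {u : ℝ → ℝ} (hu : MemL2 u) : AEStronglyMeasurable u :=
  (locallyIntegrable_of_periodic hu.1 hu.integrable).aestronglyMeasurable

/-- A periodic function is integrable against the Poisson-like weight `1 / (1 + s²)`, at every
centre. -/
lemma integrable_div_one_add_sq {v : ℝ → ℝ} (hper : Function.Periodic v (2 * π))
    (hv : Integrable v circleMeasure) (x : ℝ) :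
    Integrable fun y => (1 + (x - y) ^ 2)⁻¹ * v y := by
  have hm : AEStronglyMeasurable v := (locallyIntegrable_of_periodic hper hv).aestronglyMeasurable
  have hkm : Measurable fun s : ℝ => ‖(1 + s ^ 2)⁻¹‖ₑ := by fun_prop
  -- Tonelli gives finiteness only for almost every centre. One good centre `a` is enough, because
  -- the weights at two centres are comparable.
  have hT := lintegral_convolution hkm hm.enorm fun x => by simp only [hper x]
  have hfin : ∫⁻ α, (∫⁻ β, ‖(1 + (α - β) ^ 2)⁻¹‖ₑ * ‖v β‖ₑ) ∂circleMeasure ≠ ⊤ := by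
    rw [hT]
    exact ENNReal.mul_ne_top integrable_inv_one_add_sq.2.ne hv.2.ne
  have hae := ae_lt_top' (by
    have hk2 : Measurable fun p : ℝ × ℝ => ‖(1 + (p.1 - p.2) ^ 2)⁻¹‖ₑ := by fun_prop
    exact (hk2.aemeasurable.mul hm.enorm.comp_snd).lintegral_prod_right') hfin
  have : (ae circleMeasure).NeBot := by
    rw [ae_neBot]
    intro h0
    have : circleMeasure univ = 0 := by rw [h0]; simp
    simp [circleMeasure, Real.pi_pos.not_ge, ← two_mul] at this
  obtain ⟨a, ha⟩ := hae.exists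
  have hInt : Integrable fun y => (1 + (a - y) ^ 2)⁻¹ * v y := by
    refine ⟨?_, ?_⟩
    · exact (by fun_prop : Measurable fun y : ℝ => (1 + (a - y) ^ 2)⁻¹).aestronglyMeasurable.mul hm
    · simpa only [HasFiniteIntegral, enorm_mul] using ha
  refine (hInt.norm.const_mul (2 * (1 + (x - a) ^ 2))).mono' ?_ (Eventually.of_forall fun y => ?_)
  · exact (by fun_prop : Measurable fun y : ℝ => (1 + (x - y) ^ 2)⁻¹).aestronglyMeasurable.mul hm
  · have h1 : 0 < 1 + (a - y) ^ 2 := by positivity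
    have h2 : 0 < 1 + (x - y) ^ 2 := by positivity
    rw [norm_mul, norm_mul, ← mul_assoc]
    refine mul_le_mul_of_nonneg_right ?_ (norm_nonneg _)
    rw [norm_inv, norm_inv, Real.norm_of_nonneg h1.le, Real.norm_of_nonneg h2.le,
      ← div_eq_mul_inv, inv_le_comm₀ h2 (by positivity), inv_div, div_le_iff₀ (by positivity)]
    nlinarith [sq_nonneg ((x - y) - (x - a)), sq_nonneg ((x - y) + (x - a)),
      mul_nonneg (sq_nonneg (x - y)) (sq_nonneg (x - a))]

/-! ### A step function comparable to `1 / s` -/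

/-- The odd function equal to `1 / (2πk)` on `[2πk, 2π(k+1))` for `k ≥ 1` and to `0` on `[0, 2π)`. Its
principal value convolution with a periodic function vanishes. -/
def stepInv (s : ℝ) : ℝ :=
  (if 0 ≤ s then 1 else -1) * (2 * π * (⌊|s| / (2 * π)⌋₊ : ℝ))⁻¹

lemma measurable_stepInv : Measurable stepInv := by
  unfold stepInv
  refine Measurable.mul ?_ ?_
  · exact Measurable.ite measurableSet_Ici measurable_const measurable_const
  · refine Measurable.inv (measurable_const.mul ?_)
    exact (measurable_from_top (f := fun n : ℕ => (n : ℝ))).comp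
      (Nat.measurable_floor.comp ((continuous_abs.measurable).div_const _))

lemma stepInv_eq_zero {s : ℝ} (hs : |s| < 2 * π) : stepInv s = 0 := by
  have : ⌊|s| / (2 * π)⌋₊ = 0 := by
    rw [Nat.floor_eq_zero, div_lt_one Real.two_pi_pos]; exact hs
  -- The convention `0⁻¹ = 0` makes the step function vanish where the floor is `0`.
  simp [stepInv, this]

lemma stepInv_neg (s : ℝ) : stepInv (-s) = -stepInv s := by
  rcases lt_trichotomy s 0 with h | h | h
  · simp [stepInv, h.le, h.not_ge]
  -- The sign factor is not odd at `s = 0`, but the value there is `0`.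
  · rw [h, neg_zero, stepInv_eq_zero (by simpa using Real.pi_pos)]; simp
  · simp [stepInv, h.le, h.not_ge]

lemma stepInv_eq {n : ℕ} {s : ℝ} (h1 : 2 * π * n ≤ s) (h2 : s < 2 * π * (n + 1)) :
    stepInv s = (2 * π * n)⁻¹ := by
  have hs : 0 ≤ s := le_trans (by positivity) h1
  have : ⌊s / (2 * π)⌋₊ = n := by
    rw [Nat.floor_eq_iff (by positivity), le_div_iff₀ Real.two_pi_pos, div_lt_iff₀ Real.two_pi_pos]
    constructor <;> linarith
  simp [stepInv, hs, abs_of_nonneg hs, this]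

/-- For `2πn ≤ s < 2π(n+1)` the difference is `(s - 2πn) / (2πn s)`. The numerator is at most `2π`,
and `n ≥ 1` forces `2πn ≥ s/2`. -/
lemma abs_inv_sub_stepInv_le {s : ℝ} (hs : 2 * π ≤ |s|) : |s⁻¹ - stepInv s| ≤ 4 * π / s ^ 2 := by
  wlog h0 : 0 ≤ s generalizing s
  · have := this (s := -s) (by simpa using hs) (by linarith)
    rw [stepInv_neg, inv_neg, neg_sq, ← abs_neg] at this
    convert this using 2; ring
  rw [abs_of_nonneg h0] at hs
  have hpi := Real.pi_pos
  have hs0 : 0 < s := by linarith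
  set n := ⌊s / (2 * π)⌋₊ with hn
  have h1 : 2 * π * n ≤ s := by
    have := Nat.floor_le (a := s / (2 * π)) (by positivity)
    rw [le_div_iff₀ (by positivity)] at this; linarith
  have h2 : s < 2 * π * (n + 1) := by
    have := Nat.lt_floor_add_one (s / (2 * π))
    rw [div_lt_iff₀ (by positivity)] at this; linarith
  have hn1 : (1 : ℝ) ≤ n := by
    have : 1 ≤ n := by
      rw [hn, Nat.one_le_floor_iff, le_div_iff₀ (by positivity)]; linarith
    exact_mod_cast this
  rw [stepInv_eq h1 h2]
  have hp : 0 < 2 * π * n := by positivity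
  have hhalf : s / 2 ≤ 2 * π * n := by nlinarith
  rw [abs_sub_comm, abs_of_nonneg (sub_nonneg.2 (inv_anti₀ hp h1)), inv_sub_inv hp.ne' hs0.ne',
    div_le_div_iff₀ (by positivity) (by positivity)]
  have h3 : s - 2 * π * n ≤ 2 * π := by linarith
  calc (s - 2 * π * n) * s ^ 2 ≤ 2 * π * s ^ 2 := by gcongr
    _ = 4 * π * (s / 2 * s) := by ring
    _ ≤ 4 * π * (2 * π * n * s) := by gcongr

lemma abs_stepInv_le (s : ℝ) : |stepInv s| ≤ 1 := by
  have hpi := Real.pi_gt_three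
  have h : |stepInv s| = |(2 * π * (⌊|s| / (2 * π)⌋₊ : ℝ))⁻¹| := by
    unfold stepInv; split_ifs <;> simp
  rw [h]
  rcases Nat.eq_zero_or_pos ⌊|s| / (2 * π)⌋₊ with h0 | h0
  · simp [h0]
  · have : (1 : ℝ) ≤ ⌊|s| / (2 * π)⌋₊ := by exact_mod_cast h0
    rw [abs_of_nonneg (by positivity)]
    exact inv_le_one_of_one_le₀ (by nlinarith)

lemma tendsto_stepInv_atTop : Tendsto stepInv atTop (𝓝 0) := by
  have h1 : Tendsto (fun s : ℝ => |s|⁻¹ + 4 * π / s ^ 2) atTop (𝓝 0) := by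
    have a := tendsto_inv_atTop_zero.comp (tendsto_abs_atTop_atTop (G := ℝ))
    have b : Tendsto (fun s : ℝ => 4 * π / s ^ 2) atTop (𝓝 0) :=
      tendsto_const_nhds.div_atTop (tendsto_pow_atTop two_ne_zero)
    simpa using a.add b
  refine squeeze_zero_norm' ?_ h1
  filter_upwards [eventually_ge_atTop (2 * π)] with s hs
  have h := abs_inv_sub_stepInv_le (s := s) (hs.trans (le_abs_self s))
  have h2 := abs_sub_abs_le_abs_sub (stepInv s) s⁻¹
  rw [abs_sub_comm, abs_inv] at h2
  rw [Real.norm_eq_abs]; linarith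

lemma intervalIntegrable_stepInv_mul {w : ℝ → ℝ} {a b : ℝ} (hw : IntervalIntegrable w volume a b)
    (f : ℝ → ℝ) (hf : Measurable f) :
    IntervalIntegrable (fun s => stepInv (f s) * w s) volume a b := by
  rw [intervalIntegrable_iff] at hw ⊢
  refine hw.norm.mono' ((measurable_stepInv.comp hf).aestronglyMeasurable.mul hw.1)
    (Eventually.of_forall fun s => ?_)
  rw [norm_mul]
  exact mul_le_of_le_one_left (norm_nonneg _) (abs_stepInv_le _)

/-- The integral of `stepInv` against a periodic function of mean zero tends to zero. -/
lemma tendsto_integral_stepInv_mul {w : ℝ → ℝ} (hper : Function.Periodic w (2 * π))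
    (hw : ∀ a b, IntervalIntegrable w volume a b) (h0 : ∫ s in 0..(2 * π), w s = 0) :
    Tendsto (fun R => ∫ s in 0..R, stepInv s * w s) atTop (𝓝 0) := by
  have hpi := Real.pi_pos
  have hσw : ∀ a b, IntervalIntegrable (fun s => stepInv s * w s) volume a b := fun a b =>
    intervalIntegrable_stepInv_mul (hw a b) id measurable_id
  -- The step function is constant on each period, so complete periods contribute a multiple of the
  -- mean of `w`, that is, zero. Only the last incomplete period survives, with the small factor
  -- `(2πn)⁻¹`.
  have hpart : ∀ (n : ℕ) (R : ℝ), 2 * π * n ≤ R → R ≤ 2 * π * (n + 1) →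
      ∫ s in (2 * π * n)..R, stepInv s * w s = (2 * π * n)⁻¹ * ∫ s in (2 * π * n)..R, w s := by
    intro n R h1 h2
    rw [← intervalIntegral.integral_const_mul]
    refine intervalIntegral.integral_congr_Ioo_of_le h1 fun s hs => ?_
    simp only [stepInv_eq hs.1.le (hs.2.trans_le h2)]
  have hfull : ∀ (g : ℝ → ℝ) (_ : Function.Periodic g (2 * π)) (n : ℕ),
      ∫ s in (2 * π * n)..(2 * π * (n + 1)), g s = ∫ s in 0..(2 * π), g s := by
    intro g hg n
    have := hg.intervalIntegral_add_eq (2 * π * n) 0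
    rw [zero_add] at this
    rw [← this]; congr 1; ring
  have hzero : ∀ n : ℕ, ∫ s in 0..(2 * π * n), stepInv s * w s = 0 := by
    intro n
    induction n with
    | zero => simp
    | succ n ih =>
      push_cast
      rw [← intervalIntegral.integral_add_adjacent_intervals (hσw 0 (2 * π * n)) (hσw _ _), ih,
        hpart n _ (by nlinarith) le_rfl, hfull w hper n, h0]
      simp
  have hlim : Tendsto (fun R : ℝ => (2 * π * (⌊R / (2 * π)⌋₊ : ℝ))⁻¹ * ∫ s in 0..(2 * π), |w s|)
      atTop (𝓝 0) := by
    have : Tendsto (fun R : ℝ => 2 * π * (⌊R / (2 * π)⌋₊ : ℝ)) atTop atTop := by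
      refine Tendsto.const_mul_atTop (by positivity) (tendsto_natCast_atTop_atTop.comp ?_)
      exact tendsto_nat_floor_atTop.comp (tendsto_id.atTop_div_const (by positivity))
    simpa using (tendsto_inv_atTop_zero.comp this).mul_const (∫ s in 0..(2 * π), |w s|)
  refine squeeze_zero_norm' ?_ hlim
  filter_upwards [eventually_ge_atTop 0] with R hR
  set n := ⌊R / (2 * π)⌋₊ with hn
  have h1 : 2 * π * n ≤ R := by
    have := Nat.floor_le (a := R / (2 * π)) (by positivity)
    rw [le_div_iff₀ (by positivity)] at this; linarith
  have h2 : R ≤ 2 * π * (n + 1) := by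
    have := Nat.lt_floor_add_one (R / (2 * π))
    rw [div_lt_iff₀ (by positivity)] at this; linarith
  rw [← intervalIntegral.integral_add_adjacent_intervals (hσw 0 (2 * π * n)) (hσw _ _), hzero,
    zero_add, hpart n R h1 h2, norm_mul, Real.norm_of_nonneg (by positivity)]
  gcongr
  refine (intervalIntegral.norm_integral_le_integral_norm h1).trans ?_
  rw [← hfull (fun s => |w s|) (fun s => by simp only [hper s]) n]
  exact intervalIntegral.integral_mono_interval le_rfl h1 h2
    (Eventually.of_forall fun s => abs_nonneg _) (hw _ _).abs

/-- The symmetric truncations of the convolution of `stepInv` with a periodic function tend to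
zero. -/
lemma tendsto_integral_stepInv_convolution {v : ℝ → ℝ} (hper : Function.Periodic v (2 * π))
    (hv : Integrable v circleMeasure) (x : ℝ) :
    Tendsto (fun R => ∫ y in (x - R)..(x + R), stepInv (x - y) * v y) atTop (𝓝 0) := by
  have hv' := intervalIntegrable_of_periodic hper hv
  have hminus : ∀ a b, IntervalIntegrable (fun s => v (x - s)) volume a b := fun a b => by
    simpa using (hv' (x - a) (x - b)).comp_sub_left x
  have hplus : ∀ a b, IntervalIntegrable (fun s => v (x + s)) volume a b := fun a b => by
    simpa using (hv' (x + a) (x + b)).comp_add_left x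
  have hpm : Function.Periodic (fun s => v (x - s)) (2 * π) := fun s => by
    have := hper (x - (s + 2 * π)); dsimp only; rw [← this]; congr 1; ring
  have hpp : Function.Periodic (fun s => v (x + s)) (2 * π) := fun s => by
    have := hper (x + s); dsimp only; rw [← this]; congr 1; ring
  -- Oddness folds the symmetric integral onto `[0, R]` against `v(x - s) - v(x + s)`, which has
  -- mean zero over a period even when `v` does not.
  have key := tendsto_integral_stepInv_mul (w := fun s => v (x - s) - v (x + s))
    (hpm.sub hpp) (fun a b => (hminus a b).sub (hplus a b)) (by
      rw [intervalIntegral.integral_sub (hminus _ _) (hplus _ _),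
        intervalIntegral.integral_comp_sub_left v x, intervalIntegral.integral_comp_add_left v x,
        sub_zero, add_zero, sub_eq_zero]
      have := hper.intervalIntegral_add_eq (x - 2 * π) x
      rwa [sub_add_cancel] at this)
  refine key.congr fun R => ?_
  have e0 : ∫ y in (x - R)..(x + R), stepInv (x - y) * v y =
      ∫ s in (-R)..R, stepInv s * v (x - s) := by
    have := intervalIntegral.integral_comp_sub_left (a := -R) (b := R)
      (fun y => stepInv (x - y) * v y) x
    simp only [sub_sub_cancel, sub_neg_eq_add] at this
    exact this.symm
  have e1 : ∫ s in (-R)..0, stepInv s * v (x - s) = -∫ s in 0..R, stepInv s * v (x + s) := by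
    have := intervalIntegral.integral_comp_neg (a := 0) (b := R)
      (fun s => stepInv s * v (x - s))
    simp only [neg_zero, stepInv_neg, sub_neg_eq_add, neg_mul] at this
    rw [← this, intervalIntegral.integral_neg]
  have i1 : ∀ a b, IntervalIntegrable (fun s => stepInv s * v (x - s)) volume a b := fun a b =>
    intervalIntegrable_stepInv_mul (hminus a b) id measurable_id
  have i2 : ∀ a b, IntervalIntegrable (fun s => stepInv s * v (x + s)) volume a b := fun a b =>
    intervalIntegrable_stepInv_mul (hplus a b) id measurable_id
  rw [e0, ← intervalIntegral.integral_add_adjacent_intervals (i1 (-R) 0) (i1 0 R), e1]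
  simp only [mul_sub]
  rw [intervalIntegral.integral_sub (i1 _ _) (i2 _ _)]
  ring

/-! ### Integral operators with a kernel dominated by a convolution kernel -/

/-- A measurable kernel on the plane, invariant under diagonal shifts and dominated by an integrable
function of the difference of the variables. -/
structure IsDominatedKernel (H : ℝ → ℝ → ℝ) (q : ℝ → ℝ) : Prop where
  measurable : Measurable (Function.uncurry H)
  periodic : ∀ α β, H (α + 2 * π) (β + 2 * π) = H α β
  measurable_bound : Measurable q
  integrable_bound : Integrable q
  le_bound : ∀ α β, |H α β| ≤ q (α - β)

namespace IsDominatedKernel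

variable {H : ℝ → ℝ → ℝ} {q u : ℝ → ℝ}

lemma enorm_le (hH : IsDominatedKernel H q) (α β : ℝ) : ‖H α β‖ₑ ≤ ‖q (α - β)‖ₑ :=
  enorm_le_iff_norm_le.2 ((hH.le_bound α β).trans (le_abs_self _))

lemma periodic_integral (hH : IsDominatedKernel H q) (hu : Function.Periodic u (2 * π)) :
    Function.Periodic (fun α => ∫ β, H α β * u β) (2 * π) := fun α => by
  dsimp only
  rw [← integral_add_right_eq_self _ (2 * π)]
  simp only [hH.periodic, hu _]

lemma l2Norm_integral_le (hH : IsDominatedKernel H q) (hu : MemL2 u) :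
    l2Norm (fun α => ∫ β, H α β * u β) ≤ (∫⁻ s, ‖q s‖ₑ) * l2Norm u := by
  refine l2Norm_le_of_convolution hH.measurable_bound.enorm hu.aestronglyMeasurable hu.1
    fun α => (enorm_integral_le_lintegral_enorm _).trans (lintegral_mono fun β => ?_)
  dsimp only
  rw [enorm_mul]
  gcongr
  exact hH.enorm_le α β

lemma memL2_integral (hH : IsDominatedKernel H q) (hu : MemL2 u) :
    MemL2 (fun α => ∫ β, H α β * u β) := by
  refine ⟨hH.periodic_integral hu.1, ?_, ?_⟩
  · have : AEStronglyMeasurable (fun p : ℝ × ℝ => H p.1 p.2 * u p.2)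
        (circleMeasure.prod volume) :=
      hH.measurable.aestronglyMeasurable.mul hu.aestronglyMeasurable.comp_snd
    exact this.integral_prod_right'
  · exact (hH.l2Norm_integral_le hu).trans_lt
      (ENNReal.mul_lt_top hH.integrable_bound.2 hu.2.2)

lemma integrable_left (hH : IsDominatedKernel H q) {φ : ℝ → ℝ} (hφ : Continuous φ)
    {B : ℝ} (hB : ∀ x, |φ x| ≤ B) (β : ℝ) : Integrable fun α => H α β * φ α := by
  refine ((hH.integrable_bound.comp_sub_right β).mul_const B).mono' ?_
    (Eventually.of_forall fun α => ?_)
  · exact ((hH.measurable.comp (measurable_id.prodMk measurable_const)).mul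
      hφ.measurable).aestronglyMeasurable
  · rw [norm_mul]
    exact mul_le_mul (hH.le_bound α β) (hB α) (norm_nonneg _)
      ((abs_nonneg _).trans (hH.le_bound α β))

/-- The adjoint of the operator with kernel `H` is the operator with the transposed kernel. -/
lemma integral_mul_eq (hH : IsDominatedKernel H q) (hu : MemL2 u) {φ : ℝ → ℝ}
    (hφ : Continuous φ) (hφp : Function.Periodic φ (2 * π)) {B : ℝ} (hB : ∀ x, |φ x| ≤ B) :
    ∫ α, (∫ β, H α β * u β) * φ α ∂circleMeasure =
      ∫ β, u β * (∫ α, H α β * φ α) ∂circleMeasure := by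
  have hq : Measurable fun s => ‖q s‖ₑ := hH.measurable_bound.enorm
  have hconv := lintegral_convolution hq hu.aestronglyMeasurable.enorm
    fun x => by simp only [hu.1 x]
  have hper : ∀ α β, (fun p : ℝ × ℝ => H p.1 p.2 * u p.2 * φ p.1) (α + 2 * π, β + 2 * π) =
      (fun p : ℝ × ℝ => H p.1 p.2 * u p.2 * φ p.1) (α, β) := fun α β => by
    simp only [hH.periodic, hu.1 β, hφp α]
  have hint1 : Integrable (fun p : ℝ × ℝ => H p.1 p.2 * u p.2) (circleMeasure.prod volume) := by
    refine ⟨hH.measurable.aestronglyMeasurable.mul hu.aestronglyMeasurable.comp_snd, ?_⟩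
    have hm : AEMeasurable (fun p : ℝ × ℝ => ‖q (p.1 - p.2)‖ₑ * ‖u p.2‖ₑ)
        (circleMeasure.prod volume) :=
      (hq.comp (measurable_fst.sub measurable_snd)).aemeasurable.mul
        hu.aestronglyMeasurable.enorm.comp_snd
    calc ∫⁻ p, ‖H p.1 p.2 * u p.2‖ₑ ∂(circleMeasure.prod volume)
        ≤ ∫⁻ p, ‖q (p.1 - p.2)‖ₑ * ‖u p.2‖ₑ ∂(circleMeasure.prod volume) := by
          refine lintegral_mono fun p => ?_
          dsimp only
          rw [enorm_mul]
          gcongr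
          exact hH.enorm_le _ _
      _ = (∫⁻ s, ‖q s‖ₑ) * ∫⁻ β, ‖u β‖ₑ ∂circleMeasure := by
          rw [lintegral_prod _ hm, ← hconv]
      _ < ⊤ := ENNReal.mul_lt_top hH.integrable_bound.2 hu.integrable.2
  have hint : Integrable (fun p : ℝ × ℝ => H p.1 p.2 * u p.2 * φ p.1)
      (circleMeasure.prod volume) :=
    hint1.mul_bdd (c := B) (hφ.comp continuous_fst).aestronglyMeasurable
      (Eventually.of_forall fun p => hB p.1)
  -- Fubini on both sides: on the left `α` runs over a period and `β` over the line, on the right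
  -- the reverse.
  have h := integral_unfold (H := fun p : ℝ × ℝ => H p.1 p.2 * u p.2 * φ p.1) hper
  rw [integral_prod _ hint, integral_prod_symm _ (integrable_unfold
    (H := fun p : ℝ × ℝ => H p.1 p.2 * u p.2 * φ p.1) hper hint)] at h
  simp only [integral_mul_const] at h
  rw [h]
  refine integral_congr_ae (Eventually.of_forall fun β => ?_)
  dsimp only
  rw [← integral_const_mul]
  refine integral_congr_ae (Eventually.of_forall fun α => ?_)
  dsimp only
  ring

end IsDominatedKernel

/-! ### Smoothing kernels -/

/-- The kernels considered below. `K` is, up to a remainder dominated by `e`, equal to `b(β) / (α - β)` at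
infinity; its derivative `K'` in the first variable is dominated by the integrable function `k`, and
its singularities on the diagonal are removable. -/
structure IsSmoothingKernel (K K' : ℝ → ℝ → ℝ) (b e k : ℝ → ℝ) : Prop where
  measurable_kernel : Measurable (Function.uncurry K)
  periodic_kernel : ∀ α β, K (α + 2 * π) (β + 2 * π) = K α β
  continuous_coeff : Continuous b
  periodic_coeff : Function.Periodic b (2 * π)
  measurable_bound : Measurable e
  exists_bound : ∃ c, ∀ s, e s ≤ c * (1 + s ^ 2)⁻¹
  le_bound : ∀ α β, |K α β - b β * stepInv (α - β)| ≤ e (α - β)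
  dominated_deriv : IsDominatedKernel K' k
  hasDerivAt : ∀ α β, α ≠ β → HasDerivAt (fun a => K a β) (K' α β) α
  exists_limit : ∀ β, ∃ l, Tendsto (fun a => K a β) (𝓝[≠] β) (𝓝 l)

lemma exists_bound_of_periodic {f : ℝ → ℝ} (hf : Continuous f)
    (hp : Function.Periodic f (2 * π)) : ∃ B, ∀ x, |f x| ≤ B := by
  obtain ⟨B, hB⟩ := (hp.isBounded_of_continuous Real.two_pi_pos.ne' hf).exists_norm_le
  exact ⟨B, fun x => hB _ (mem_range_self x)⟩

lemma periodic_deriv_of_periodic {φ : ℝ → ℝ} (hφp : Function.Periodic φ (2 * π)) :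
    Function.Periodic (deriv φ) (2 * π) := fun x => by
  rw [← deriv_comp_add_const]
  congr 1
  funext y; exact hφp y

namespace IsSmoothingKernel

variable {K K' : ℝ → ℝ → ℝ} {b e k u : ℝ → ℝ}

lemma bound_nonneg (hK : IsSmoothingKernel K K' b e k) (s : ℝ) : 0 ≤ e s := by
  have := (abs_nonneg _).trans (hK.le_bound s 0)
  rwa [sub_zero] at this

lemma dominated_remainder (hK : IsSmoothingKernel K K' b e k) :
    IsDominatedKernel (fun α β => K α β - b β * stepInv (α - β)) e where
  measurable := hK.measurable_kernel.sub
    ((hK.continuous_coeff.measurable.comp measurable_snd).mul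
      (measurable_stepInv.comp (measurable_fst.sub measurable_snd)))
  periodic α β := by
    simp only [hK.periodic_kernel, hK.periodic_coeff β, add_sub_add_right_eq_sub]
  measurable_bound := hK.measurable_bound
  integrable_bound := by
    obtain ⟨c, hc⟩ := hK.exists_bound
    refine (integrable_inv_one_add_sq.const_mul c).mono' hK.measurable_bound.aestronglyMeasurable
      (Eventually.of_forall fun s => ?_)
    rw [Real.norm_of_nonneg (hK.bound_nonneg s)]
    exact hc s
  le_bound := hK.le_bound

/-- The explicit decay `c / (1 + s²)`, rather than mere integrability of `e`, is what gives
integrability at every `α` and not just almost every one. -/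
lemma integrable_remainder (hK : IsSmoothingKernel K K' b e k) (hu : MemL2 u) (α : ℝ) :
    Integrable fun β => (K α β - b β * stepInv (α - β)) * u β := by
  obtain ⟨c, hc⟩ := hK.exists_bound
  refine ((integrable_div_one_add_sq hu.1 hu.integrable α).norm.const_mul c).mono' ?_
    (Eventually.of_forall fun β => ?_)
  · exact (hK.dominated_remainder.measurable.comp
      (measurable_const.prodMk measurable_id)).aestronglyMeasurable.mul hu.aestronglyMeasurable
  · rw [norm_mul, norm_mul, ← mul_assoc, norm_inv,
      Real.norm_of_nonneg (by positivity : (0 : ℝ) ≤ 1 + (α - β) ^ 2)]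
    exact mul_le_mul_of_nonneg_right ((hK.le_bound α β).trans (hc _)) (norm_nonneg _)

lemma pvSet_subset (α ε R : ℝ) : pvSet α ε R ⊆ Ioo (α - R) (α + R) := by
  intro β hβ
  have := abs_lt.1 hβ.2
  constructor <;> linarith

lemma measurableSet_pvSet (α ε R : ℝ) : MeasurableSet (pvSet α ε R) := by
  have h : Measurable fun β : ℝ => |α - β| := (continuous_const.sub continuous_id).abs.measurable
  exact (measurableSet_lt measurable_const h).inter (measurableSet_lt h measurable_const)

lemma integrableOn_Ioo_stepInv_mul {v : ℝ → ℝ} (hper : Function.Periodic v (2 * π))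
    (hv : Integrable v circleMeasure) (x R : ℝ) :
    IntegrableOn (fun y => stepInv (x - y) * v y) (Ioo (x - R) (x + R)) := by
  rcases le_total (x - R) (x + R) with h | h
  · exact ((intervalIntegrable_iff_integrableOn_Ioo_of_le h).1 (intervalIntegrable_stepInv_mul
      (intervalIntegrable_of_periodic hper hv _ _) (fun y => x - y) (by fun_prop)))
  · rw [Ioo_eq_empty_of_le h]; exact integrableOn_empty

/-- The kernel splits into the remainder, whose truncations converge by dominated convergence, and
`b * stepInv`, whose symmetric truncations against the periodic function `b * u` tend to zero. -/
lemma hasPV (hK : IsSmoothingKernel K K' b e k) (hu : MemL2 u) (α : ℝ) :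
    HasPV (fun β => K α β * u β) α (∫ β, (K α β - b β * stepInv (α - β)) * u β) := by
  have hE := hK.integrable_remainder hu α
  obtain ⟨B, hB⟩ := exists_bound_of_periodic hK.continuous_coeff hK.periodic_coeff
  have hv : Integrable (fun β => b β * u β) circleMeasure :=
    hu.integrable.bdd_mul hK.continuous_coeff.aestronglyMeasurable
      (Eventually.of_forall hB)
  have hvp : Function.Periodic (fun β => b β * u β) (2 * π) := hK.periodic_coeff.mul hu.1
  have hσ : ∀ ε R, IntegrableOn (fun β => stepInv (α - β) * (b β * u β)) (pvSet α ε R) :=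
    fun ε R => (integrableOn_Ioo_stepInv_mul hvp hv α R).mono_set (pvSet_subset α ε R)
  have hsplit : (fun β => K α β * u β) = fun β =>
      (K α β - b β * stepInv (α - β)) * u β + stepInv (α - β) * (b β * u β) := by
    funext β; ring
  refine ⟨fun ε R _ => ?_, ?_⟩
  · rw [hsplit]
    exact hE.integrableOn.add (hσ ε R)
  · have h1 : Tendsto (fun p : ℝ × ℝ => ∫ β in pvSet α p.1 p.2,
        (K α β - b β * stepInv (α - β)) * u β) (𝓝[>] 0 ×ˢ atTop)
        (𝓝 (∫ β, (K α β - b β * stepInv (α - β)) * u β)) := by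
      simp_rw [← integral_indicator (measurableSet_pvSet _ _ _)]
      refine tendsto_integral_filter_of_dominated_convergence _
        (Eventually.of_forall fun p => hE.1.indicator (measurableSet_pvSet _ _ _))
        (Eventually.of_forall fun p => Eventually.of_forall fun β => ?_) hE.norm ?_
      · exact norm_indicator_le_norm_self _ _
      · have hne : ∀ᵐ β : ℝ, β ≠ α := by
          simp [ae_iff, measure_singleton]
        filter_upwards [hne] with β hβ
        refine tendsto_const_nhds.congr' ?_
        have hpos : 0 < |α - β| := abs_pos.2 (sub_ne_zero.2 hβ.symm)
        have a1 : ∀ᶠ ε : ℝ in 𝓝[>] 0, ε < |α - β| :=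
          eventually_nhdsWithin_of_eventually_nhds (eventually_lt_nhds hpos)
        filter_upwards [a1.prod_mk (eventually_gt_atTop |α - β|)] with p hp
        rw [indicator_of_mem]
        exact hp
    have h2 : Tendsto (fun p : ℝ × ℝ => ∫ β in pvSet α p.1 p.2,
        stepInv (α - β) * (b β * u β)) (𝓝[>] 0 ×ˢ atTop) (𝓝 0) := by
      refine ((tendsto_integral_stepInv_convolution hvp hv α).comp tendsto_snd).congr' ?_
      -- For `ε < 2π` the inner truncation only removes points where `stepInv` vanishes.
      have a1 : ∀ᶠ ε : ℝ in 𝓝[>] 0, ε < 2 * π :=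
        eventually_nhdsWithin_of_eventually_nhds (eventually_lt_nhds Real.two_pi_pos)
      filter_upwards [a1.prod_mk (eventually_gt_atTop 0)] with p hp
      have hR : (0 : ℝ) < p.2 := hp.2
      rw [Function.comp_apply, intervalIntegral.integral_of_le (by linarith),
        integral_Ioc_eq_integral_Ioo]
      refine setIntegral_eq_of_subset_of_forall_sdiff_eq_zero measurableSet_Ioo
        (pvSet_subset _ _ _) fun β hβ => ?_
      rw [stepInv_eq_zero, zero_mul]
      have hlt : |α - β| < p.2 := by
        rw [abs_lt]; constructor <;> linarith [hβ.1.1, hβ.1.2]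
      by_contra! hcon
      exact hβ.2 ⟨lt_of_lt_of_le hp.1 hcon, hlt⟩
    have h3 := h1.add h2
    rw [add_zero] at h3
    refine h3.congr fun p => ?_
    rw [hsplit, integral_add hE.integrableOn (hσ _ _)]

lemma pv_eq (hK : IsSmoothingKernel K K' b e k) (hu : MemL2 u) (α : ℝ) :
    pv (fun β => K α β * u β) α = ∫ β, (K α β - b β * stepInv (α - β)) * u β :=
  (hK.hasPV hu α).2.limUnder_eq

/-- Integration by parts over a symmetric interval around the singularity. -/
lemma integral_by_parts_interval (hK : IsSmoothingKernel K K' b e k) {φ : ℝ → ℝ}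
    (hφ : ContDiff ℝ ∞ φ) (β R : ℝ)
    (hi : IntervalIntegrable (fun α => K' α β * φ α + K α β * deriv φ α) volume (β - R) (β + R))
    (hR : 0 < R) :
    ∫ α in (β - R)..(β + R), K' α β * φ α + K α β * deriv φ α =
      K (β + R) β * φ (β + R) - K (β - R) β * φ (β - R) := by
  obtain ⟨l, hl⟩ := hK.exists_limit β
  -- Filling in the limit at `β` makes the primitive continuous, so the fundamental theorem of
  -- calculus off one point applies and the diagonal produces no boundary term.
  set L : ℝ → ℝ := Function.update (fun a => K a β) β l with hL
  have hLne : ∀ a, a ≠ β → L a = K a β := fun a ha => Function.update_of_ne ha _ _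
  have hLev : ∀ a, a ≠ β → L =ᶠ[𝓝 a] fun a => K a β := fun a ha => by
    filter_upwards [isOpen_ne.mem_nhds ha] with x hx using hLne x hx
  have hLc : Continuous L := by
    rw [continuous_iff_continuousAt]
    intro a
    by_cases ha : a = β
    · rw [ha]; exact continuousAt_update_same.2 hl
    · exact ((hK.hasDerivAt a β ha).continuousAt).congr (hLev a ha).symm
  have hd : ∀ a, HasDerivAt φ (deriv φ a) a := fun a =>
    ((hφ.differentiable (by simp)) a).hasDerivAt
  have := integral_eq_of_hasDerivAt_off_countable (fun a => L a * φ a)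
    (fun α => K' α β * φ α + K α β * deriv φ α) (countable_singleton β)
    (hLc.mul hφ.continuous).continuousOn (fun a ha => by
      have hne : a ≠ β := ha.2
      have := ((hK.hasDerivAt a β hne).congr_of_eventuallyEq (hLev a hne)).mul (hd a)
      rwa [hLne a hne] at this) hi
  rw [this, hLne _ (by linarith), hLne _ (by linarith)]

/-- Integration by parts over the line. -/
lemma integral_remainder_mul_deriv (hK : IsSmoothingKernel K K' b e k) {φ : ℝ → ℝ}
    (hφ : ContDiff ℝ ∞ φ) (hφp : Function.Periodic φ (2 * π)) (β : ℝ) :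
    ∫ α, (K α β - b β * stepInv (α - β)) * deriv φ α = -∫ α, K' α β * φ α := by
  have hφ'c : Continuous (deriv φ) := hφ.continuous_deriv (by simp)
  have hφ'p := periodic_deriv_of_periodic hφp
  obtain ⟨B, hB⟩ := exists_bound_of_periodic hφ.continuous hφp
  obtain ⟨B', hB'⟩ := exists_bound_of_periodic hφ'c hφ'p
  have i1 := hK.dominated_remainder.integrable_left hφ'c hB' β
  have i2 := hK.dominated_deriv.integrable_left hφ.continuous hB β
  have hφ'i : Integrable (deriv φ) circleMeasure :=
    (hφ'c.integrableOn_Ioc : IntegrableOn _ (Ioc (-π) π) volume)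
  have i3 : ∀ x y, IntervalIntegrable (fun α => stepInv (β - α) * deriv φ α) volume x y :=
    fun x y => intervalIntegrable_stepInv_mul (hφ'c.intervalIntegrable _ _) (fun α => β - α)
      (by fun_prop)
  have hlo : Tendsto (fun R : ℝ => β - R) atTop atBot := by
    simpa [sub_eq_add_neg] using tendsto_atBot_add_const_left atTop β tendsto_neg_atTop_atBot
  have hhi : Tendsto (fun R : ℝ => β + R) atTop atTop :=
    tendsto_atTop_add_const_left atTop β tendsto_id
  have l1 := intervalIntegral_tendsto_integral i1 hlo hhi
  have l2 := intervalIntegral_tendsto_integral i2 hlo hhi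
  -- By oddness, adding `-b β * stepInv (β - α)` restores the part subtracted from `K`; as `deriv φ`
  -- is periodic, its contribution tends to zero.
  have l3 := (tendsto_integral_stepInv_convolution hφ'p hφ'i β).const_mul (-b β)
  -- Both boundary terms vanish in the limit, since `K` is at most `c / (1 + R²) + |b β| |stepInv
  -- R|` at distance `R` from `β`.
  have hbd : ∀ (f : ℝ → ℝ), (∀ R, |f R - β| = |R|) →
      (∀ R, |stepInv (f R - β)| = |stepInv R|) →
      Tendsto (fun R => K (f R) β * φ (f R)) atTop (𝓝 0) := by
    intro f hf hσ
    obtain ⟨c, hc⟩ := hK.exists_bound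
    have hz : Tendsto (fun R : ℝ => (c * (1 + R ^ 2)⁻¹ + |b β| * |stepInv R|) * B) atTop (𝓝 0) := by
      have t1 : Tendsto (fun R : ℝ => (1 + R ^ 2)⁻¹) atTop (𝓝 0) :=
        tendsto_inv_atTop_zero.comp
          (tendsto_atTop_add_const_left _ _ (tendsto_pow_atTop two_ne_zero))
      simpa using ((t1.const_mul c).add (tendsto_stepInv_atTop.abs.const_mul |b β|)).mul_const B
    refine squeeze_zero_norm (fun R => ?_) hz
    rw [norm_mul]
    refine mul_le_mul ?_ (hB _) (norm_nonneg _) ?_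
    · have h1 := (hK.le_bound (f R) β).trans (hc _)
      rw [← sq_abs (f R - β), hf, sq_abs] at h1
      have h2 := abs_sub_abs_le_abs_sub (K (f R) β) (b β * stepInv (f R - β))
      rw [abs_mul, hσ] at h2
      rw [Real.norm_eq_abs]; linarith
    · have h1 := (hK.bound_nonneg R).trans (hc R)
      positivity
  have b1 := hbd (fun R => β + R) (fun R => by simp) (fun R => by simp)
  have b2 := hbd (fun R => β - R) (fun R => by simp) (fun R => by simp [stepInv_neg])
  have hsum := (l1.add l2).add l3
  have heq : (fun R : ℝ => (∫ α in (β - R)..(β + R), (K α β - b β * stepInv (α - β)) * deriv φ α) +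
      (∫ α in (β - R)..(β + R), K' α β * φ α) +
      -b β * ∫ α in (β - R)..(β + R), stepInv (β - α) * deriv φ α) =ᶠ[atTop]
      fun R => K (β + R) β * φ (β + R) - K (β - R) β * φ (β - R) := by
    filter_upwards [eventually_gt_atTop 0] with R hR
    have hs : (fun α => K' α β * φ α + K α β * deriv φ α) = fun α =>
        ((K α β - b β * stepInv (α - β)) * deriv φ α + K' α β * φ α) +
          -b β * (stepInv (β - α) * deriv φ α) := by
      funext α
      rw [show β - α = -(α - β) by ring, stepInv_neg]; ring
    have j12 := (i1.intervalIntegrable (a := β - R) (b := β + R)).add i2.intervalIntegrable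
    have j3 := (i3 (β - R) (β + R)).const_mul (-b β)
    rw [← hK.integral_by_parts_interval hφ β R (by rw [hs]; exact j12.add j3) hR, hs,
      intervalIntegral.integral_add j12 j3, intervalIntegral.integral_add i1.intervalIntegrable
      i2.intervalIntegrable, intervalIntegral.integral_const_mul]
  have hlim := tendsto_nhds_unique (hsum.congr' heq) (b1.sub b2)
  linarith

/-- The weak derivative of `PV ∫ K(α, β) u(β) dβ` is `∫ K'(α, β) u(β) dβ`. -/
lemma isWeakDeriv (hK : IsSmoothingKernel K K' b e k) (hu : MemL2 u) (c : ℝ) :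
    IsWeakDeriv (fun α => c * pv (fun β => K α β * u β) α)
      (fun α => c * ∫ β, K' α β * u β) := by
  intro φ hφ hφp
  have hφ'c : Continuous (deriv φ) := hφ.continuous_deriv (by simp)
  have hφ'p := periodic_deriv_of_periodic hφp
  obtain ⟨B, hB⟩ := exists_bound_of_periodic hφ.continuous hφp
  obtain ⟨B', hB'⟩ := exists_bound_of_periodic hφ'c hφ'p
  simp only [hK.pv_eq hu, mul_assoc, integral_const_mul]
  -- Both operators are transposed onto the test function, which leaves an integration by parts in
  -- `α` for each fixed `β`.
  rw [hK.dominated_remainder.integral_mul_eq hu hφ'c hφ'p hB',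
    hK.dominated_deriv.integral_mul_eq hu hφ.continuous hφp hB]
  simp only [hK.integral_remainder_mul_deriv hφ hφp, mul_neg, integral_neg]

end IsSmoothingKernel

/-! ### Convolution kernels used as bounds -/

lemma lintegral_enorm_eq_ofReal {f : ℝ → ℝ} (hf : Integrable f) (h0 : ∀ s, 0 ≤ f s) :
    ∫⁻ s, ‖f s‖ₑ = ENNReal.ofReal (∫ s, f s) := by
  rw [← ofReal_integral_norm_eq_lintegral_enorm hf]
  simp only [Real.norm_of_nonneg (h0 _)]

/-- A constant `a` on `[-R, R]` plus a multiple of `1 / (1 + s²)`. -/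
def plateau (a R c s : ℝ) : ℝ := (Icc (-R) R).indicator (fun _ => a) s + c * (1 + s ^ 2)⁻¹

lemma measurable_plateau (a R c : ℝ) : Measurable (plateau a R c) :=
  (measurable_const.indicator measurableSet_Icc).add (by fun_prop)

lemma integrable_plateau (a R c : ℝ) : Integrable (plateau a R c) := by
  refine Integrable.add ?_ (integrable_inv_one_add_sq.const_mul c)
  rw [integrable_indicator_iff measurableSet_Icc]
  exact integrableOn_const (by simp)

lemma plateau_nonneg {a c : ℝ} (R : ℝ) (ha : 0 ≤ a) (hc : 0 ≤ c) (s : ℝ) : 0 ≤ plateau a R c s :=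
  add_nonneg (indicator_nonneg (fun _ _ => ha) s) (by positivity)

lemma lintegral_plateau {a R c : ℝ} (ha : 0 ≤ a) (hR : 0 ≤ R) (hc : 0 ≤ c) :
    ∫⁻ s, ‖plateau a R c s‖ₑ = ENNReal.ofReal (2 * R * a + c * π) := by
  rw [lintegral_enorm_eq_ofReal (integrable_plateau a R c) (plateau_nonneg R ha hc)]
  congr 1
  unfold plateau
  rw [integral_add _ (integrable_inv_one_add_sq.const_mul c), integral_const_mul,
    integral_univ_inv_one_add_sq, integral_indicator measurableSet_Icc]
  · simp [Measure.real, hR, two_mul]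
  · rw [integrable_indicator_iff measurableSet_Icc]
    exact integrableOn_const (by simp)

lemma exists_plateau_le {a : ℝ} (R c : ℝ) (ha : 0 ≤ a) :
    ∃ c', ∀ s, plateau a R c s ≤ c' * (1 + s ^ 2)⁻¹ := by
  refine ⟨a * (1 + R ^ 2) + c, fun s => ?_⟩
  rw [plateau, add_mul]
  refine add_le_add ?_ le_rfl
  by_cases hs : s ∈ Icc (-R) R
  · rw [indicator_of_mem hs, ← div_eq_mul_inv, le_div_iff₀ (by positivity)]
    have : s ^ 2 ≤ R ^ 2 := sq_le_sq' hs.1 hs.2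
    gcongr
  · rw [indicator_of_notMem hs]; positivity

lemma le_plateau_of_abs_le {a R c s : ℝ} (hc : 0 ≤ c) (hs : |s| ≤ R) : a ≤ plateau a R c s := by
  rw [plateau, indicator_of_mem (mem_Icc.2 (abs_le.1 hs))]
  have : 0 ≤ c * (1 + s ^ 2)⁻¹ := by positivity
  linarith

lemma div_sq_le_inv_one_add_sq {c s : ℝ} (hc : 0 ≤ c) (hs : 1 ≤ |s|) :
    c / s ^ 2 ≤ 2 * c * (1 + s ^ 2)⁻¹ := by
  have h1 : 1 ≤ s ^ 2 := by rw [← sq_abs]; nlinarith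
  rw [← div_eq_mul_inv, div_le_div_iff₀ (by linarith) (by positivity)]
  nlinarith

lemma le_plateau_of_le_abs {a R c s : ℝ} (ha : 0 ≤ a) (hc : 0 ≤ c) (hs : 1 ≤ |s|) :
    c / s ^ 2 ≤ plateau a R (2 * c) s := by
  have : 0 ≤ (Icc (-R) R).indicator (fun _ => a) s := indicator_nonneg (fun _ _ => ha) s
  have := div_sq_le_inv_one_add_sq hc hs
  rw [plateau]; linarith

/-- The integrable singularity `|s|^{δ-1}`, cut off at `|s| = 1`. -/
def cutPower (δ s : ℝ) : ℝ := if |s| ≤ 1 then |s| ^ (δ - 1) else 0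

lemma measurable_cutPower (δ : ℝ) : Measurable (cutPower δ) := by
  have h : Measurable fun s : ℝ => |s| := continuous_abs.measurable
  exact Measurable.ite (measurableSet_le h measurable_const) (h.pow_const _) measurable_const

lemma cutPower_nonneg (δ s : ℝ) : 0 ≤ cutPower δ s := by
  unfold cutPower; split_ifs <;> positivity

lemma integral_cutPower {δ : ℝ} (hδ : 0 < δ) : ∫ s, cutPower δ s = 2 / δ := by
  have h := integral_comp_abs (f := fun t : ℝ => if t ≤ 1 then t ^ (δ - 1) else 0)
  have h2 : ∫ t in Ioi (0 : ℝ), (if t ≤ 1 then t ^ (δ - 1) else 0) = 1 / δ := by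
    have e : (fun t : ℝ => if t ≤ 1 then t ^ (δ - 1) else 0) =
        (Iic 1).indicator fun t : ℝ => t ^ (δ - 1) := by
      funext t; simp [indicator_apply]
    rw [e, setIntegral_indicator measurableSet_Iic, Ioi_inter_Iic,
      ← intervalIntegral.integral_of_le zero_le_one, integral_rpow (Or.inl (by linarith))]
    simp [hδ.ne']
  rw [h2] at h
  unfold cutPower
  rw [h]; ring

/-- The Bochner integral of a non-integrable function is `0` by convention, whereas this integral is
`2 / δ ≠ 0`. -/
lemma integrable_cutPower {δ : ℝ} (hδ : 0 < δ) : Integrable (cutPower δ) := by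
  by_contra h
  have := integral_undef h
  rw [integral_cutPower hδ] at this
  exact (by positivity : (2 / δ : ℝ) ≠ 0) this

/-! ### Curves -/

/-- Quantitative regularity of a periodic curve. -/
structure CurveBound (δ M : ℝ) (z : ℝ → ℂ) : Prop where
  contDiff : ContDiff ℝ 2 z
  periodic : IsPeriodicCurve z
  pi_le : π ≤ M
  deviation : ∀ α : ℝ, ‖z α - α‖ ≤ 2 * M
  norm_deriv : ∀ α, ‖deriv z α‖ ≤ M
  norm_deriv2 : ∀ α, ‖deriv (deriv z) α‖ ≤ M
  holder : ∀ α β, ‖deriv (deriv z) α - deriv (deriv z) β‖ ≤ M * |α - β| ^ δ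

/-- Quantitative arc-chord condition. -/
structure ChordBound (F : ℝ) (z : ℝ → ℂ) : Prop where
  one_le : 1 ≤ F
  chord : ∀ α β, (α - β) ^ 2 ≤ F * ‖z α - z β‖ ^ 2
  deriv_ne : ∀ α, deriv z α ≠ 0

lemma enorm_le_toReal {x : ℂ} {a : ℝ≥0∞} (ha : a ≠ ⊤) (h : ‖x‖ₑ ≤ a) : ‖x‖ ≤ a.toReal := by
  rw [← toReal_enorm]; exact ENNReal.toReal_mono ha h

lemma IsPeriodicCurve.periodic_sub {z : ℝ → ℂ} (hz : IsPeriodicCurve z) :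
    Function.Periodic (fun α : ℝ => z α - α) (2 * π) := fun α => by
  dsimp only
  rw [hz α]; push_cast; ring

lemma IsPeriodicCurve.periodic_deriv {z : ℝ → ℂ} (hz : IsPeriodicCurve z) :
    Function.Periodic (deriv z) (2 * π) := fun α => by
  rw [← deriv_comp_add_const, show (fun x => z (x + 2 * π)) = fun x => z x + ((2 * π : ℝ) : ℂ) from
    funext hz, deriv_add_const]

/-- The bound `π ≤ M` comes from the period itself: `2π = ‖z π - z (-π)‖ ≤ 2M`. It also bounds the
parameter on one period, and hence the periodic function `z α - α` everywhere. -/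
lemma curveBound_of_isC2Holder {δ : ℝ} {z : ℝ → ℂ} (hz : IsPeriodicCurve z)
    (h : IsC2Holder δ z) (hδ : 0 < δ) : CurveBound δ (holderNorm δ z).toReal z := by
  have htop := h.2.ne
  have h0 : ∀ α ∈ Icc (-π) π, ‖z α‖ ≤ (holderNorm δ z).toReal := fun α hα => by
    refine enorm_le_toReal htop ?_
    refine le_trans (le_iSup₂ (f := fun (α : ℝ) (_ : α ∈ Icc (-π) π) => ‖z α‖ₑ) α hα) ?_
    unfold holderNorm
    rw [add_assoc, add_assoc]; exact le_self_add
  have hpi := Real.pi_pos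
  have hpiM : π ≤ (holderNorm δ z).toReal := by
    have h1 := h0 π ⟨by linarith, le_rfl⟩
    have h2 := h0 (-π) ⟨le_rfl, by linarith⟩
    have h3 := hz (-π)
    rw [show -π + 2 * π = π by ring] at h3
    have h4 : ‖((2 * π : ℝ) : ℂ)‖ ≤ ‖z π‖ + ‖z (-π)‖ := by
      rw [← sub_eq_iff_eq_add'.2 h3]; exact norm_sub_le _ _
    rw [Complex.norm_real, Real.norm_of_nonneg (by positivity)] at h4
    linarith
  refine ⟨h.1, hz, hpiM, fun α => ?_, fun α => ?_, fun α => ?_, fun α β => ?_⟩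
  · obtain ⟨y, hy, hαy⟩ := hz.periodic_sub.exists_mem_Ioc Real.two_pi_pos α (-π)
    rw [← Ioc_neg_pi_pi] at hy
    rw [hαy]
    refine (norm_sub_le _ _).trans ?_
    have h1 := h0 y ⟨hy.1.le, hy.2⟩
    have h2 : ‖(y : ℂ)‖ ≤ π := by
      rw [Complex.norm_real]; exact abs_le.2 ⟨hy.1.le, hy.2⟩
    linarith
  · refine enorm_le_toReal htop ((le_iSup (fun α => ‖deriv z α‖ₑ) α).trans ?_)
    unfold holderNorm
    rw [add_assoc, add_assoc]; exact le_self_add.trans le_add_self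
  · refine enorm_le_toReal htop ((le_iSup (fun α => ‖deriv (deriv z) α‖ₑ) α).trans ?_)
    unfold holderNorm
    rw [add_assoc]; exact le_self_add.trans le_add_self
  · by_cases hαβ : α = β
    · rw [hαβ, sub_self, norm_zero]; positivity
    have h1 : ‖deriv (deriv z) α - deriv (deriv z) β‖ₑ / ‖α - β‖ₑ ^ δ ≤ holderNorm δ z :=
      (le_iSup₂ (f := fun α β : ℝ =>
        ‖deriv (deriv z) α - deriv (deriv z) β‖ₑ / ‖α - β‖ₑ ^ δ) α β).trans le_add_self
    have hne : ‖α - β‖ₑ ≠ 0 := by simpa [sub_eq_zero] using hαβ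
    rw [ENNReal.div_le_iff (by simp [hne]) (by simp [hδ.le])] at h1
    have h2 := enorm_le_toReal (ENNReal.mul_ne_top htop (by simp [hδ.le])) h1
    rwa [ENNReal.toReal_mul, ← ENNReal.toReal_rpow, toReal_enorm, Real.norm_eq_abs] at h2

/-- Since `D ≥ 1`, the square root of `D` may be replaced by `D`, which keeps roots out of later
estimates. -/
lemma le_mul_of_sq_le_mul_sq {D x : ℝ} (hD : 1 ≤ D) (hx : 0 ≤ x) {t : ℝ}
    (h : t ^ 2 ≤ D * x ^ 2) : t ≤ D * x := by
  refine abs_le_of_sq_le_sq' ?_ (by positivity) |>.2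
  rw [mul_pow]
  nlinarith [sq_nonneg x]

/-- The lower bound `1 ≤ F` comes from the chord over a full period, whose ratio is exactly `1`. A
zero of the derivative is excluded by the value of `arcChord` at `β = 0`, where `1 / 0 = ⊤`. -/
lemma chordBound_of_arcChordNorm {z : ℝ → ℂ} (hz : IsPeriodicCurve z)
    (h : arcChordNorm z < ⊤) : ChordBound (arcChordNorm z).toReal z := by
  have hle : ∀ α β, arcChord z α β ≤ arcChordNorm z := fun α β =>
    le_iSup₂ (f := fun α β => arcChord z α β) α β
  have hchord : ∀ α β, (α - β) ^ 2 ≤ (arcChordNorm z).toReal * ‖z α - z β‖ ^ 2 := by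
    intro α β
    by_cases hαβ : α = β
    · simp [hαβ]
    have h1 := hle α (α - β)
    have hne : α - β ≠ 0 := sub_ne_zero.2 hαβ
    rw [arcChord, if_neg hne, sub_sub_cancel] at h1
    have hz0 : ‖z α - z β‖ₑ ≠ 0 := by
      intro h0
      rw [h0] at h1
      rw [zero_pow two_ne_zero, ENNReal.div_zero (by simpa using hne)] at h1
      exact absurd h (not_lt.2 h1)
    rw [ENNReal.div_le_iff (by simpa using hz0) (by simp)] at h1
    have h2 := ENNReal.toReal_mono (ENNReal.mul_ne_top h.ne (by simp)) h1
    simpa using h2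
  refine ⟨?_, hchord, fun α h0 => ?_⟩
  · have h1 := hchord (0 + 2 * π) 0
    have h2 := hz 0
    rw [h2, show z 0 + ((2 * π : ℝ) : ℂ) - z 0 = ((2 * π : ℝ) : ℂ) by ring, Complex.norm_real, Real.norm_eq_abs, sq_abs] at h1
    have : 0 < (2 * π) ^ 2 := by positivity
    simp only [zero_add, sub_zero] at h1
    nlinarith
  · have h1 := hle α 0
    rw [arcChord, if_pos rfl, h0] at h1
    simp at h1
    exact h.ne h1

lemma dist_bound {z h : ℝ → ℂ} (hd : distNorm z h < ⊤) (α β : ℝ) :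
    1 ≤ (max 1 (distNorm z h)).toReal * ‖z α - h β‖ ^ 2 := by
  have h1 : 1 / ‖z α - h β‖ₑ ^ 2 ≤ max 1 (distNorm z h) :=
    (le_iSup₂ (f := fun α β => 1 / ‖z α - h β‖ₑ ^ 2) α β).trans (le_max_right _ _)
  have htop : max 1 (distNorm z h) ≠ ⊤ := (max_lt ENNReal.one_lt_top hd).ne
  have hz0 : ‖z α - h β‖ₑ ≠ 0 := by
    intro h0
    rw [h0, zero_pow two_ne_zero, ENNReal.div_zero one_ne_zero, top_le_iff] at h1
    exact htop h1
  rw [ENNReal.div_le_iff (by simpa using hz0) (by simp)] at h1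
  have h2 := ENNReal.toReal_mono (ENNReal.mul_ne_top htop (by simp)) h1
  simpa using h2

namespace CurveBound

variable {δ M : ℝ} {z : ℝ → ℂ}

lemma hasDerivAt (hz : CurveBound δ M z) (α : ℝ) : HasDerivAt z (deriv z α) α :=
  (hz.contDiff.differentiable (by norm_num) α).hasDerivAt

lemma contDiff_deriv (hz : CurveBound δ M z) : ContDiff ℝ 1 (deriv z) :=
  ((contDiff_succ_iff_deriv (n := 1)).1 hz.contDiff).2.2

lemma hasDerivAt_deriv (hz : CurveBound δ M z) (α : ℝ) :
    HasDerivAt (deriv z) (deriv (deriv z) α) α :=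
  (hz.contDiff_deriv.differentiable (by norm_num) α).hasDerivAt

lemma continuous (hz : CurveBound δ M z) : Continuous z := hz.contDiff.continuous

lemma continuous_deriv (hz : CurveBound δ M z) : Continuous (deriv z) :=
  hz.contDiff_deriv.continuous

lemma norm_deriv_sub_le (hz : CurveBound δ M z) (α β : ℝ) :
    ‖deriv z α - deriv z β‖ ≤ M * |α - β| :=
  convex_univ.norm_image_sub_le_of_norm_hasDerivWithin_le
    (fun x _ => (hz.hasDerivAt_deriv x).hasDerivWithinAt) (fun x _ => hz.norm_deriv2 x)
    (mem_univ β) (mem_univ α)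

lemma norm_sub_le (hz : CurveBound δ M z) (α β : ℝ) : ‖z α - z β‖ ≤ M * |α - β| :=
  convex_univ.norm_image_sub_le_of_norm_hasDerivWithin_le
    (fun x _ => (hz.hasDerivAt x).hasDerivWithinAt) (fun x _ => hz.norm_deriv x)
    (mem_univ β) (mem_univ α)

lemma M_nonneg (hz : CurveBound δ M z) : 0 ≤ M := Real.pi_pos.le.trans hz.pi_le

lemma one_le (hz : CurveBound δ M z) : 1 ≤ M := by linarith [hz.pi_le, Real.pi_gt_three]

/-- First order Taylor estimate. -/
lemma taylor_one (hz : CurveBound δ M z) (α β : ℝ) :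
    ‖z α - z β - (α - β : ℝ) * deriv z β‖ ≤ M * |α - β| ^ 2 := by
  have hd : ∀ x ∈ uIcc β α, HasDerivWithinAt (fun x : ℝ => z x - (x - β : ℝ) * deriv z β)
      (deriv z x - deriv z β) (uIcc β α) x := fun x _ => by
    have h1 := ((hasDerivAt_id x).sub_const β).ofReal_comp.mul_const (deriv z β)
    exact (((hz.hasDerivAt x).sub h1).congr_deriv (by simp)).hasDerivWithinAt
  have := (convex_uIcc β α).norm_image_sub_le_of_norm_hasDerivWithin_le hd
    (C := M * |α - β|) (fun x hx => (hz.norm_deriv_sub_le x β).trans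
      (mul_le_mul_of_nonneg_left (abs_sub_left_of_mem_uIcc hx) hz.M_nonneg))
    left_mem_uIcc right_mem_uIcc
  rw [Real.norm_eq_abs] at this
  convert this using 1
  · congr 1; push_cast; ring
  · ring

/-- The mean value inequality applied to the remainder, whose derivative is controlled by the Hölder
condition along the whole segment. `taylor_two` repeats the argument one order higher. -/
lemma taylor_one_deriv (hz : CurveBound δ M z) (hδ : 0 ≤ δ) (α β : ℝ) :
    ‖deriv z α - deriv z β - (α - β : ℝ) * deriv (deriv z) β‖ ≤ M * |α - β| ^ δ * |α - β| := by
  have hd : ∀ x ∈ uIcc β α, HasDerivWithinAt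
      (fun x : ℝ => deriv z x - (x - β : ℝ) * deriv (deriv z) β)
      (deriv (deriv z) x - deriv (deriv z) β) (uIcc β α) x := fun x _ => by
    have h1 := ((hasDerivAt_id x).sub_const β).ofReal_comp.mul_const (deriv (deriv z) β)
    exact (((hz.hasDerivAt_deriv x).sub h1).congr_deriv (by simp)).hasDerivWithinAt
  have := (convex_uIcc β α).norm_image_sub_le_of_norm_hasDerivWithin_le hd
    (C := M * |α - β| ^ δ) (fun x hx => (hz.holder x β).trans
      (mul_le_mul_of_nonneg_left (Real.rpow_le_rpow (abs_nonneg _)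
        (abs_sub_left_of_mem_uIcc hx) hδ) hz.M_nonneg))
    left_mem_uIcc right_mem_uIcc
  rw [Real.norm_eq_abs] at this
  convert this using 1
  congr 1; push_cast; ring

/-- Second order Taylor estimate. -/
lemma taylor_two (hz : CurveBound δ M z) (hδ : 0 ≤ δ) (α β : ℝ) :
    ‖z α - z β - (α - β : ℝ) * deriv z β - ((α - β : ℝ) : ℂ) ^ 2 / 2 * deriv (deriv z) β‖ ≤
      M * |α - β| ^ δ * |α - β| ^ 2 := by
  have hd : ∀ x ∈ uIcc β α, HasDerivWithinAt
      (fun x : ℝ => z x - (x - β : ℝ) * deriv z β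
        - ((x - β : ℝ) : ℂ) ^ 2 / 2 * deriv (deriv z) β)
      (deriv z x - deriv z β - (x - β : ℝ) * deriv (deriv z) β) (uIcc β α) x := fun x _ => by
    have h0 := ((hasDerivAt_id x).sub_const β).ofReal_comp
    have h1 := h0.mul_const (deriv z β)
    have h2 := ((h0.pow 2).div_const 2).mul_const (deriv (deriv z) β)
    exact ((((hz.hasDerivAt x).sub h1).sub h2).congr_deriv (by simp)).hasDerivWithinAt
  have := (convex_uIcc β α).norm_image_sub_le_of_norm_hasDerivWithin_le hd
    (C := M * |α - β| ^ δ * |α - β|) (fun x hx => (hz.taylor_one_deriv hδ x β).trans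
      (by
        have h1 := abs_sub_left_of_mem_uIcc hx
        have h2 := Real.rpow_le_rpow (abs_nonneg _) h1 hδ
        have h3 := hz.M_nonneg
        gcongr))
    left_mem_uIcc right_mem_uIcc
  rw [Real.norm_eq_abs] at this
  convert this using 1
  · congr 1; push_cast; ring
  · ring

end CurveBound

/-! ### The kernels of the four entries -/

/-- The kernel `(x(α) - y(β))^⊥ · ∂y(β) / |x(α) - y(β)|² = Im (∂y(β) / (x(α) - y(β)))`. -/
def adjKernel (x y : ℝ → ℂ) (α β : ℝ) : ℝ := (deriv y β / (x α - y β)).im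

/-- The derivative of `adjKernel` in its first variable. -/
def adjKernelDeriv (x y : ℝ → ℂ) (α β : ℝ) : ℝ :=
  (-(deriv y β * deriv x α) / (x α - y β) ^ 2).im

lemma adjIntegrand_eq (x y : ℝ → ℂ) (u : ℝ → ℝ) (α : ℝ) :
    adjIntegrand x y u α = fun β => adjKernel x y α β * u β := by
  funext β
  unfold adjIntegrand adjKernel
  congr 1
  rw [Complex.inner, Complex.div_im, ← Complex.normSq_eq_norm_sq]
  simp
  ring

/-- This discards the real poles `1 / (α - β)` and `-1 / (α - β)²` before taking absolute values. -/
lemma abs_im_le_norm_sub_ofReal (w : ℂ) (t : ℝ) : |w.im| ≤ ‖w - t‖ := by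
  simpa using Complex.abs_im_le_norm (w - t)

section

variable {δ M N : ℝ} {x y : ℝ → ℂ}

lemma measurable_adjKernel (hx : CurveBound δ M x) (hy : CurveBound δ N y) :
    Measurable (Function.uncurry (adjKernel x y)) := by
  have h1 := hx.continuous.measurable
  have h2 := hy.continuous.measurable
  have h3 := hy.continuous_deriv.measurable
  exact Complex.measurable_im.comp ((h3.comp measurable_snd).div
    ((h1.comp measurable_fst).sub (h2.comp measurable_snd)))

lemma measurable_adjKernelDeriv (hx : CurveBound δ M x) (hy : CurveBound δ N y) :
    Measurable (Function.uncurry (adjKernelDeriv x y)) := by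
  have h1 := hx.continuous.measurable
  have h2 := hy.continuous.measurable
  have h3 := hy.continuous_deriv.measurable
  have h4 := hx.continuous_deriv.measurable
  exact Complex.measurable_im.comp
    ((((h3.comp measurable_snd).mul (h4.comp measurable_fst)).neg).div
    (((h1.comp measurable_fst).sub (h2.comp measurable_snd)).pow_const 2))

lemma adjKernel_add_period (hx : IsPeriodicCurve x) (hy : IsPeriodicCurve y) (α β : ℝ) :
    adjKernel x y (α + 2 * π) (β + 2 * π) = adjKernel x y α β := by
  unfold adjKernel
  rw [hx α, hy β, hy.periodic_deriv β, add_sub_add_right_eq_sub]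

lemma adjKernelDeriv_add_period (hx : IsPeriodicCurve x) (hy : IsPeriodicCurve y) (α β : ℝ) :
    adjKernelDeriv x y (α + 2 * π) (β + 2 * π) = adjKernelDeriv x y α β := by
  unfold adjKernelDeriv
  rw [hx α, hy β, hy.periodic_deriv β, hx.periodic_deriv α, add_sub_add_right_eq_sub]

lemma hasDerivAt_adjKernel (hx : CurveBound δ M x) {α β : ℝ} (h : x α - y β ≠ 0) :
    HasDerivAt (fun a => adjKernel x y a β) (adjKernelDeriv x y α β) α := by
  have h1 : HasDerivAt (fun a => deriv y β / (x a - y β))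
      (-(deriv y β * deriv x α) / (x α - y β) ^ 2) α :=
    ((hasDerivAt_const α (deriv y β)).div ((hx.hasDerivAt α).sub_const (y β)) h).congr_deriv
      (by simp)
  exact Complex.imCLM.hasFDerivAt.comp_hasDerivAt α h1

/-- Each curve stays within bounded distance of its parameter, so chords are `α - β` up to a bounded
error; this governs the kernels at infinity. -/
lemma norm_sub_sub_le (hx : CurveBound δ M x) (hy : CurveBound δ N y) (α β : ℝ) :
    ‖x α - y β - (α - β : ℝ)‖ ≤ 2 * (M + N) := by
  have h : x α - y β - (α - β : ℝ) = (x α - α) - (y β - β) := by push_cast; ring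
  rw [h]
  refine (norm_sub_le _ _).trans ?_
  linarith [hx.deviation α, hy.deviation β]

/-- At large distances the kernel is close to a multiple of `stepInv`. -/
lemma adjKernel_far (hx : CurveBound δ M x) (hy : CurveBound δ N y) {c α β : ℝ}
    (hs : 2 * π ≤ |α - β|) (hc : |α - β| ≤ c * ‖x α - y β‖) :
    |adjKernel x y α β - (deriv y β).im * stepInv (α - β)| ≤
      (2 * N * (M + N) * c + 4 * π * N) / (α - β) ^ 2 := by
  have hpi := Real.pi_pos
  have hs0 : 0 < |α - β| := by linarith
  have hsne : α - β ≠ 0 := abs_pos.1 hs0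
  have hN := hy.M_nonneg
  have hM := hx.M_nonneg
  have hΔ : 0 < ‖x α - y β‖ := by
    rcases (norm_nonneg (x α - y β)).eq_or_lt' with h | h
    · rw [h, mul_zero] at hc; linarith
    · exact h
  have hΔne : x α - y β ≠ 0 := norm_pos_iff.1 hΔ
  -- The comparison passes through `Im ∂y(β) / (α - β)`: replacing the chord by `α - β` costs
  -- `O(1/s²)`, and so does replacing `1/s` by the step function.
  have h1 : |adjKernel x y α β - (deriv y β).im * (α - β)⁻¹| ≤
      2 * N * (M + N) * c / (α - β) ^ 2 := by
    have e : adjKernel x y α β - (deriv y β).im * (α - β)⁻¹ =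
        (deriv y β * -(x α - y β - (α - β : ℝ)) / ((x α - y β) * (α - β : ℝ))).im := by
      have e1 : deriv y β * -(x α - y β - (α - β : ℝ)) / ((x α - y β) * (α - β : ℝ)) =
          deriv y β / (x α - y β) - ((α - β)⁻¹ : ℝ) * deriv y β := by
        have : ((α - β : ℝ) : ℂ) ≠ 0 := by exact_mod_cast hsne
        rw [Complex.ofReal_inv]
        field_simp
        ring
      rw [e1, Complex.sub_im, Complex.im_ofReal_mul, mul_comm, adjKernel]
    rw [e]
    refine (Complex.abs_im_le_norm _).trans ?_
    rw [norm_div, norm_mul, norm_mul, norm_neg, Complex.norm_real, Real.norm_eq_abs,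
      div_le_div_iff₀ (by positivity) (by positivity), ← sq_abs]
    have h2 := norm_sub_sub_le hx hy α β
    have h3 := hy.norm_deriv β
    calc ‖deriv y β‖ * ‖x α - y β - (α - β : ℝ)‖ * |α - β| ^ 2
        ≤ N * (2 * (M + N)) * |α - β| ^ 2 := by gcongr
      _ = N * (2 * (M + N)) * |α - β| * |α - β| := by ring
      _ ≤ N * (2 * (M + N)) * |α - β| * (c * ‖x α - y β‖) := by gcongr
      _ = _ := by ring
  have h2 : |(deriv y β).im * (α - β)⁻¹ - (deriv y β).im * stepInv (α - β)| ≤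
      4 * π * N / (α - β) ^ 2 := by
    rw [← mul_sub, abs_mul]
    have a1 := (Complex.abs_im_le_norm (deriv y β)).trans (hy.norm_deriv β)
    have a2 := abs_inv_sub_stepInv_le hs
    calc _ ≤ N * (4 * π / (α - β) ^ 2) := by gcongr
      _ = _ := by ring
  calc _ ≤ _ := abs_sub_le _ ((deriv y β).im * (α - β)⁻¹) _
    _ ≤ _ := add_le_add h1 h2
    _ = _ := by ring

end

/-! ### Kernels of a curve with itself -/

section Diagonal

variable {δ M F : ℝ} {z : ℝ → ℂ}

lemma ChordBound.abs_le (hF : ChordBound F z) (α β : ℝ) : |α - β| ≤ F * ‖z α - z β‖ :=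
  le_mul_of_sq_le_mul_sq hF.one_le (norm_nonneg _) (by rw [sq_abs]; exact hF.chord α β)

lemma ChordBound.sub_ne_zero (hF : ChordBound F z) {α β : ℝ} (h : α ≠ β) : z α - z β ≠ 0 := by
  intro h0
  have := hF.abs_le α β
  rw [h0, norm_zero, mul_zero] at this
  exact h (sub_eq_zero.1 (abs_nonpos_iff.1 this))

/-- Once the real pole is removed, the numerator is a first order Taylor remainder of size `M s²`
and the denominator is at least `s² / F`. On the diagonal the kernel is `0` by division by zero. -/
lemma abs_adjKernel_self_le (hz : CurveBound δ M z) (hF : ChordBound F z) (α β : ℝ) :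
    |adjKernel z z α β| ≤ M * F := by
  have hM := hz.M_nonneg
  have hF0 := zero_le_one.trans hF.one_le
  by_cases h : α = β
  · rw [h]; simp only [adjKernel, sub_self, div_zero, Complex.zero_im, abs_zero]; positivity
  have hs : α - β ≠ 0 := sub_ne_zero.2 h
  have hsC : ((α - β : ℝ) : ℂ) ≠ 0 := by exact_mod_cast hs
  have hs0 : 0 < |α - β| := abs_pos.2 hs
  have hΔ := hF.sub_ne_zero h
  have hΔ0 := norm_pos_iff.2 hΔ
  refine (abs_im_le_norm_sub_ofReal _ (α - β)⁻¹).trans ?_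
  have e : deriv z β / (z α - z β) - ((α - β)⁻¹ : ℝ) =
      -(z α - z β - (α - β : ℝ) * deriv z β) / ((z α - z β) * (α - β : ℝ)) := by
    rw [Complex.ofReal_inv]
    field_simp
    ring
  rw [e, norm_div, norm_neg, norm_mul, Complex.norm_real, Real.norm_eq_abs,
    div_le_iff₀ (by positivity)]
  calc _ ≤ M * |α - β| ^ 2 := hz.taylor_one α β
    _ = M * |α - β| * |α - β| := by ring
    _ ≤ M * |α - β| * (F * ‖z α - z β‖) := by gcongr; exact hF.abs_le α β
    _ = _ := by ring

lemma adjKernel_self_remainder_le (hz : CurveBound δ M z) (hF : ChordBound F z) (α β : ℝ) :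
    |adjKernel z z α β - (deriv z β).im * stepInv (α - β)| ≤
      plateau 0 0 (50 * (M ^ 2 * F)) (α - β) := by
  have hM := hz.M_nonneg
  have hM1 := hz.one_le
  have hF0 := zero_le_one.trans hF.one_le
  have hpi := Real.pi_pos
  have hpi3 := Real.pi_gt_three
  by_cases hs : 2 * π ≤ |α - β|
  · have h1 := adjKernel_far hz hz hs (hF.abs_le α β)
    refine h1.trans ((?_ : _ ≤ 25 * (M ^ 2 * F) / (α - β) ^ 2).trans
      ((le_plateau_of_le_abs (R := 0) le_rfl (by positivity) (by linarith)).trans_eq (by ring_nf)))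
    gcongr
    have h2 : 4 * π * M ≤ 4 * M * M := by gcongr; exact hz.pi_le
    nlinarith [hF.one_le, mul_le_mul_of_nonneg_left hF.one_le (sq_nonneg M)]
  · push Not at hs
    rw [stepInv_eq_zero hs, mul_zero, sub_zero]
    refine (abs_adjKernel_self_le hz hF α β).trans ?_
    rw [plateau, indicator_zero, zero_add, ← div_eq_mul_inv, le_div_iff₀ (by positivity)]
    -- Here `2π ≤ 7`, so `1 + s² ≤ 50`, which matches the constant `2 * 25` of the far region.
    have h1 : (α - β) ^ 2 ≤ 49 := by
      rw [← sq_abs]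
      have : |α - β| ≤ 7 := by linarith [Real.pi_lt_d2]
      nlinarith [abs_nonneg (α - β)]
    calc M * F * (1 + (α - β) ^ 2) ≤ M * F * 50 := by gcongr; linarith
      _ = 50 * (M * 1 * F) := by ring
      _ ≤ 50 * (M * M * F) := by gcongr
      _ = _ := by ring

/-- The cancellation that makes the differentiated kernel integrable. -/
lemma norm_deriv_mul_deriv_sub_le (hz : CurveBound δ M z) (hδ : 0 < δ) (hδ1 : δ ≤ 1) {α β : ℝ}
    (h : |α - β| ≤ 1) :
    ‖((α - β : ℝ) : ℂ) ^ 2 * (deriv z β * deriv z α) - (z α - z β) ^ 2‖ ≤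
      5 * M ^ 2 * |α - β| ^ δ * |α - β| ^ 3 := by
  set s : ℂ := ((α - β : ℝ) : ℂ) with hs
  set r := |α - β| with hr
  have hr0 : 0 ≤ r := abs_nonneg _
  have hsr : ‖s‖ = r := by rw [hs, Complex.norm_real, Real.norm_eq_abs]
  have hM := hz.M_nonneg
  have hrδ : r ≤ r ^ δ := by
    rcases hr0.eq_or_lt' with h0 | h0
    · rw [h0]; positivity
    · simpa using Real.rpow_le_rpow_of_exponent_ge h0 h hδ1
  set a := s * deriv z α - (z α - z β) with ha
  set b := s * deriv z β - (z α - z β) with hb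
  -- With `Δ = z α - z β` the left side is `(Δ + a)(Δ + b) - Δ²`. To leading order `a` and `b` are
  -- `±s² z''(β) / 2`, so they cancel in `a + b`, leaving `O(|s|^(2+δ))`. The product `a * b =
  -- O(s⁴)` is absorbed using `|s| ≤ 1` and `δ ≤ 1`.
  have e : s ^ 2 * (deriv z β * deriv z α) - (z α - z β) ^ 2 = (z α - z β) * (a + b) + a * b := by
    rw [ha, hb]; ring
  have hbn : ‖b‖ ≤ M * r ^ 2 := by
    rw [hb, norm_sub_rev]; exact hz.taylor_one α β
  have han : ‖a‖ ≤ M * r ^ 2 := by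
    have := hz.taylor_one β α
    rw [abs_sub_comm, ← hr] at this
    convert this using 2
    rw [ha, hs]; push_cast; ring
  have habn : ‖a + b‖ ≤ 3 * M * r ^ δ * r ^ 2 := by
    have e2 : a + b = s * (deriv z α - deriv z β - s * deriv (deriv z) β)
        - 2 * (z α - z β - s * deriv z β - s ^ 2 / 2 * deriv (deriv z) β) := by
      rw [ha, hb]; ring
    rw [e2]
    refine (norm_sub_le _ _).trans ?_
    rw [norm_mul, norm_mul, hsr, Complex.norm_ofNat]
    have t1 := hz.taylor_one_deriv hδ.le α β
    have t2 := hz.taylor_two hδ.le α β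
    calc _ ≤ r * (M * r ^ δ * r) + 2 * (M * r ^ δ * r ^ 2) := by gcongr
      _ = _ := by ring
  rw [e]
  refine (norm_add_le _ _).trans ?_
  rw [norm_mul, norm_mul]
  have hΔ : ‖z α - z β‖ ≤ M * r := hz.norm_sub_le α β
  calc _ ≤ M * r * (3 * M * r ^ δ * r ^ 2) + M * r ^ 2 * (M * r ^ 2) := by gcongr
    _ = 3 * M ^ 2 * r ^ δ * r ^ 3 + M ^ 2 * r * r ^ 3 := by ring
    _ ≤ 3 * M ^ 2 * r ^ δ * r ^ 3 + M ^ 2 * r ^ δ * r ^ 3 := by gcongr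
    _ ≤ _ := by
      have : 0 ≤ M ^ 2 * r ^ δ * r ^ 3 := by positivity
      linarith

/-- Near the diagonal the double pole `-1/s²` is real; without it the numerator is `O(|s|^(3+δ))`
over a denominator at least `s⁴ / F`. Beyond `|s| = 1` the arc-chord bound alone gives `M² F / s²`.
-/
lemma adjKernelDeriv_self_le (hz : CurveBound δ M z) (hF : ChordBound F z) (hδ : 0 < δ)
    (hδ1 : δ ≤ 1) (α β : ℝ) :
    |adjKernelDeriv z z α β| ≤
      5 * (M ^ 2 * F) * cutPower δ (α - β) + plateau 0 0 (2 * (M ^ 2 * F)) (α - β) := by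
  have hM := hz.M_nonneg
  have hF0 := zero_le_one.trans hF.one_le
  have hp := plateau_nonneg (c := 2 * (M ^ 2 * F)) 0 le_rfl (by positivity) (α - β)
  have hc := cutPower_nonneg δ (α - β)
  by_cases h : α = β
  · have : adjKernelDeriv z z α β = 0 := by rw [h]; simp [adjKernelDeriv]
    rw [this, abs_zero]; positivity
  have hs : α - β ≠ 0 := sub_ne_zero.2 h
  have hsC : ((α - β : ℝ) : ℂ) ≠ 0 := by exact_mod_cast hs
  have hs0 : 0 < |α - β| := abs_pos.2 hs
  have hΔ := hF.sub_ne_zero h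
  have hΔ0 := norm_pos_iff.2 hΔ
  rcases le_or_gt |α - β| 1 with h1 | h1
  · refine le_trans ?_ (le_add_of_nonneg_right hp)
    refine (abs_im_le_norm_sub_ofReal _ (-((α - β) ^ 2)⁻¹)).trans ?_
    have e : -(deriv z β * deriv z α) / (z α - z β) ^ 2 - ((-((α - β) ^ 2)⁻¹ : ℝ) : ℂ) =
        -(((α - β : ℝ) : ℂ) ^ 2 * (deriv z β * deriv z α) - (z α - z β) ^ 2) /
          ((z α - z β) ^ 2 * ((α - β : ℝ) : ℂ) ^ 2) := by
      rw [Complex.ofReal_neg, Complex.ofReal_inv, Complex.ofReal_pow]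
      field_simp
      ring
    rw [e, norm_div, norm_neg, norm_mul, norm_pow, norm_pow, Complex.norm_real, Real.norm_eq_abs,
      div_le_iff₀ (by positivity)]
    refine (norm_deriv_mul_deriv_sub_le hz hδ hδ1 h1).trans ?_
    have hr : |α - β| ^ δ = |α - β| ^ (δ - 1) * |α - β| := by
      rw [Real.rpow_sub_one hs0.ne', div_mul_cancel₀ _ hs0.ne']
    rw [cutPower, if_pos h1, hr]
    have hch := hF.chord α β
    rw [← sq_abs] at hch
    calc _ = 5 * M ^ 2 * |α - β| ^ (δ - 1) * |α - β| ^ 2 * |α - β| ^ 2 := by ring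
      _ ≤ 5 * M ^ 2 * |α - β| ^ (δ - 1) * (F * ‖z α - z β‖ ^ 2) * |α - β| ^ 2 := by gcongr
      _ = _ := by ring
  · refine le_trans ?_ (le_add_of_nonneg_left (by positivity))
    refine le_trans ?_ (le_plateau_of_le_abs le_rfl (by positivity) h1.le)
    refine (Complex.abs_im_le_norm _).trans ?_
    rw [norm_div, norm_neg, norm_mul, norm_pow, div_le_div_iff₀ (by positivity) (by positivity)]
    have h2 := hz.norm_deriv α
    have h3 := hz.norm_deriv β
    calc _ ≤ M * M * (F * ‖z α - z β‖ ^ 2) := by gcongr; exact hF.chord α β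
      _ = _ := by ring

/-- Minus the real pole, the quotient is `-((Δ - s z') / s²) / (Δ / s)` with `Δ = z a - z β`, and
the two Taylor expansions give the limits of its numerator and denominator. -/
lemma tendsto_adjKernel_self (hz : CurveBound δ M z) (hF : ChordBound F z) (hδ : 0 < δ) (β : ℝ) :
    Tendsto (fun a => adjKernel z z a β) (𝓝[≠] β)
      (𝓝 (-(1 / 2 * deriv (deriv z) β) / deriv z β).im) := by
  have hslope : Tendsto (fun a : ℝ => ((a - β : ℝ) : ℂ)⁻¹ * (z a - z β)) (𝓝[≠] β)
      (𝓝 (deriv z β)) := by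
    have := hasDerivAt_iff_tendsto_slope.1 (hz.hasDerivAt β)
    refine this.congr fun a => ?_
    simp [slope, Complex.real_smul]
  have hquad : Tendsto (fun a : ℝ => (((a - β : ℝ) : ℂ) ^ 2)⁻¹ *
      (z a - z β - (a - β : ℝ) * deriv z β)) (𝓝[≠] β) (𝓝 (1 / 2 * deriv (deriv z) β)) := by
    rw [tendsto_iff_norm_sub_tendsto_zero]
    have hlim : Tendsto (fun a : ℝ => M * |a - β| ^ δ) (𝓝[≠] β) (𝓝 0) := by
      have : Continuous fun a : ℝ => M * |a - β| ^ δ :=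
        continuous_const.mul (((continuous_id.sub continuous_const).abs).rpow_const
          fun _ => Or.inr hδ.le)
      have h2 := this.tendsto β
      simp only [sub_self, abs_zero, Real.zero_rpow hδ.ne', mul_zero] at h2
      exact h2.mono_left nhdsWithin_le_nhds
    refine squeeze_zero' (Eventually.of_forall fun a => norm_nonneg _) ?_ hlim
    filter_upwards [self_mem_nhdsWithin] with a ha
    have hs : a - β ≠ 0 := sub_ne_zero.2 ha
    have hsC : ((a - β : ℝ) : ℂ) ≠ 0 := by exact_mod_cast hs
    have hs0 : 0 < |a - β| := abs_pos.2 hs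
    have e : (((a - β : ℝ) : ℂ) ^ 2)⁻¹ * (z a - z β - (a - β : ℝ) * deriv z β) -
        1 / 2 * deriv (deriv z) β = (z a - z β - (a - β : ℝ) * deriv z β -
          ((a - β : ℝ) : ℂ) ^ 2 / 2 * deriv (deriv z) β) / ((a - β : ℝ) : ℂ) ^ 2 := by
      field_simp
    rw [e, norm_div, norm_pow, Complex.norm_real, Real.norm_eq_abs, div_le_iff₀ (by positivity)]
    exact hz.taylor_two hδ.le a β
  have hq := (hquad.neg).div hslope (hF.deriv_ne β)
  refine ((Complex.continuous_im.tendsto _).comp hq).congr' ?_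
  filter_upwards [self_mem_nhdsWithin] with a ha
  have hs : a - β ≠ 0 := sub_ne_zero.2 ha
  have hsC : ((a - β : ℝ) : ℂ) ≠ 0 := by exact_mod_cast hs
  have hΔ := hF.sub_ne_zero ha
  have e : -((((a - β : ℝ) : ℂ) ^ 2)⁻¹ * (z a - z β - (a - β : ℝ) * deriv z β)) /
      (((a - β : ℝ) : ℂ)⁻¹ * (z a - z β)) = deriv z β / (z a - z β) - ((a - β)⁻¹ : ℝ) := by
    rw [Complex.ofReal_inv]
    field_simp
    ring
  simp only [Function.comp_apply, Pi.div_apply]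
  rw [e, Complex.sub_im, Complex.ofReal_im, sub_zero, adjKernel]

lemma isSmoothingKernel_self (hz : CurveBound δ M z) (hF : ChordBound F z) (hδ : 0 < δ)
    (hδ1 : δ ≤ 1) :
    IsSmoothingKernel (adjKernel z z) (adjKernelDeriv z z) (fun β => (deriv z β).im)
      (plateau 0 0 (50 * (M ^ 2 * F)))
      (fun s => 5 * (M ^ 2 * F) * cutPower δ s + plateau 0 0 (2 * (M ^ 2 * F)) s) where
  measurable_kernel := measurable_adjKernel hz hz
  periodic_kernel := adjKernel_add_period hz.periodic hz.periodic
  continuous_coeff := Complex.continuous_im.comp hz.continuous_deriv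
  periodic_coeff β := by simp only [hz.periodic.periodic_deriv β]
  measurable_bound := measurable_plateau _ _ _
  exists_bound := exists_plateau_le _ _ le_rfl
  le_bound := adjKernel_self_remainder_le hz hF
  dominated_deriv :=
    { measurable := measurable_adjKernelDeriv hz hz
      periodic := adjKernelDeriv_add_period hz.periodic hz.periodic
      measurable_bound := ((measurable_cutPower δ).const_mul _).add (measurable_plateau _ _ _)
      integrable_bound := ((integrable_cutPower hδ).const_mul _).add (integrable_plateau _ _ _)
      le_bound := adjKernelDeriv_self_le hz hF hδ hδ1 }
  hasDerivAt α β h := hasDerivAt_adjKernel hz (hF.sub_ne_zero h)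
  exists_limit β := ⟨_, tendsto_adjKernel_self hz hF hδ β⟩

lemma lintegral_self_bound {A : ℝ} (hδ : 0 < δ) (hA : 0 ≤ A) :
    ∫⁻ s, ‖5 * A * cutPower δ s + plateau 0 0 (2 * A) s‖ₑ =
      ENNReal.ofReal ((10 / δ + 2 * π) * A) := by
  rw [lintegral_enorm_eq_ofReal (f := fun s => 5 * A * cutPower δ s + plateau 0 0 (2 * A) s)
    (((integrable_cutPower hδ).const_mul _).add (integrable_plateau _ _ _))
    fun s => add_nonneg (mul_nonneg (by positivity) (cutPower_nonneg _ _))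
      (plateau_nonneg 0 le_rfl (by positivity) s)]
  congr 1
  rw [integral_add ((integrable_cutPower hδ).const_mul _) (integrable_plateau _ _ _),
    integral_const_mul, integral_cutPower hδ]
  have h := lintegral_plateau (a := 0) (R := 0) (c := 2 * A) le_rfl le_rfl (by positivity)
  rw [lintegral_enorm_eq_ofReal (integrable_plateau _ _ _)
    (plateau_nonneg 0 le_rfl (by positivity)), ENNReal.ofReal_eq_ofReal_iff
    (integral_nonneg (plateau_nonneg 0 le_rfl (by positivity))) (by positivity)] at h
  rw [h]; ring

end Diagonal

/-! ### Kernels of two separated curves -/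

section Cross

variable {δ M N D : ℝ} {x y : ℝ → ℂ}

/-- At this distance the error `2 (M + N)` in `norm_sub_sub_le` is at most half of `|α - β|`. -/
lemma abs_sub_le_two_mul_norm (hx : CurveBound δ M x) (hy : CurveBound δ N y) {α β : ℝ}
    (h : 4 * (M + N) ≤ |α - β|) : |α - β| ≤ 2 * ‖x α - y β‖ := by
  have h1 := norm_sub_sub_le hx hy α β
  have h2 := norm_sub_norm_le ((α - β : ℝ) : ℂ) (x α - y β)
  rw [norm_sub_rev ((α - β : ℝ) : ℂ), Complex.norm_real, Real.norm_eq_abs] at h2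
  linarith

/-- For `|s| ≤ 4 (M + N)` the separation of the curves bounds the kernel by `N D`, and the step
function adds at most `N D`. Farther out `adjKernel_far` applies with `c = 2`. -/
lemma adjKernel_cross_remainder_le (hx : CurveBound δ M x) (hy : CurveBound δ N y) (hD : 1 ≤ D)
    (hd : ∀ α β, 1 ≤ D * ‖x α - y β‖ ^ 2) (α β : ℝ) :
    |adjKernel x y α β - (deriv y β).im * stepInv (α - β)| ≤
      plateau (2 * (N * D)) (4 * (M + N)) (16 * (N * (M + N))) (α - β) := by
  have hM := hx.M_nonneg
  have hN := hy.M_nonneg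
  have hpi := Real.pi_gt_three
  have hMpi := hx.pi_le
  have hNpi := hy.pi_le
  have hy' := hy.norm_deriv β
  rcases le_or_gt |α - β| (4 * (M + N)) with h | h
  · refine le_trans ?_ (le_plateau_of_abs_le (by positivity) h)
    refine (abs_sub _ _).trans ?_
    have h1 : |adjKernel x y α β| ≤ N * D := by
      have hle : 1 ≤ D * ‖x α - y β‖ :=
        le_mul_of_sq_le_mul_sq hD (norm_nonneg _) (by simpa using hd α β)
      have hpos : 0 < ‖x α - y β‖ := by
        rcases (norm_nonneg (x α - y β)).eq_or_lt' with h0 | h0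
        · rw [h0] at hle; linarith
        · exact h0
      refine (Complex.abs_im_le_norm _).trans ?_
      rw [norm_div, div_le_iff₀ hpos]
      nlinarith
    have h2 : |(deriv y β).im * stepInv (α - β)| ≤ N * D := by
      rw [abs_mul]
      exact mul_le_mul ((Complex.abs_im_le_norm _).trans hy') ((abs_stepInv_le _).trans hD)
        (abs_nonneg _) hN
    linarith
  · refine (adjKernel_far hx hy (by linarith) (abs_sub_le_two_mul_norm hx hy h.le)).trans ?_
    refine le_trans ?_ ((le_plateau_of_le_abs (a := 2 * (N * D))
      (R := 4 * (M + N)) (c := 8 * (N * (M + N))) (by positivity)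
      (by positivity) (by linarith)).trans_eq (by ring_nf))
    gcongr
    nlinarith [mul_le_mul_of_nonneg_right hMpi hN, mul_nonneg hN hN]

lemma adjKernelDeriv_cross_le (hx : CurveBound δ M x) (hy : CurveBound δ N y) (hD : 1 ≤ D)
    (hd : ∀ α β, 1 ≤ D * ‖x α - y β‖ ^ 2) (α β : ℝ) :
    |adjKernelDeriv x y α β| ≤ plateau (M * N * D) (4 * (M + N)) (8 * (M * N)) (α - β) := by
  have hM := hx.M_nonneg
  have hN := hy.M_nonneg
  have hpi := Real.pi_gt_three
  have hMpi := hx.pi_le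
  have hNpi := hy.pi_le
  have hy' := hy.norm_deriv β
  have hx' := hx.norm_deriv α
  have hpos : 0 < ‖x α - y β‖ ^ 2 := by
    have := hd α β
    by_contra! h0
    nlinarith
  rcases le_or_gt |α - β| (4 * (M + N)) with h | h
  · refine le_trans ?_ (le_plateau_of_abs_le (by positivity) h)
    refine (Complex.abs_im_le_norm _).trans ?_
    rw [norm_div, norm_neg, norm_mul, norm_pow, div_le_iff₀ hpos]
    calc _ ≤ N * M * 1 := by rw [mul_one]; gcongr
      _ ≤ N * M * (D * ‖x α - y β‖ ^ 2) := by gcongr; exact hd α β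
      _ = _ := by ring
  · have hs := abs_sub_le_two_mul_norm hx hy h.le
    have hs0 : 0 < |α - β| := by linarith
    have hs2 : 0 < (α - β) ^ 2 := by rw [← sq_abs]; positivity
    refine le_trans ?_ ((le_plateau_of_le_abs (a := M * N * D)
      (R := 4 * (M + N)) (c := 4 * (M * N)) (by positivity)
      (by positivity) (by linarith)).trans_eq (by ring_nf))
    refine (Complex.abs_im_le_norm _).trans ?_
    rw [norm_div, norm_neg, norm_mul, norm_pow, div_le_div_iff₀ hpos hs2, ← sq_abs]
    calc _ ≤ N * M * (2 * ‖x α - y β‖) ^ 2 := by gcongr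
      _ = _ := by ring

lemma isSmoothingKernel_cross (hx : CurveBound δ M x) (hy : CurveBound δ N y) (hD : 1 ≤ D)
    (hd : ∀ α β, 1 ≤ D * ‖x α - y β‖ ^ 2) :
    IsSmoothingKernel (adjKernel x y) (adjKernelDeriv x y) (fun β => (deriv y β).im)
      (plateau (2 * (N * D)) (4 * (M + N)) (16 * (N * (M + N))))
      (plateau (M * N * D) (4 * (M + N)) (8 * (M * N))) := by
  have hM := hx.M_nonneg
  have hN := hy.M_nonneg
  have hne : ∀ α β, x α - y β ≠ 0 := fun α β h0 => by
    have := hd α β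
    rw [h0] at this
    norm_num at this
  exact
  { measurable_kernel := measurable_adjKernel hx hy
    periodic_kernel := adjKernel_add_period hx.periodic hy.periodic
    continuous_coeff := Complex.continuous_im.comp hy.continuous_deriv
    periodic_coeff := fun β => by simp only [hy.periodic.periodic_deriv β]
    measurable_bound := measurable_plateau _ _ _
    exists_bound := exists_plateau_le _ _ (by positivity)
    le_bound := adjKernel_cross_remainder_le hx hy hD hd
    dominated_deriv :=
      { measurable := measurable_adjKernelDeriv hx hy
        periodic := adjKernelDeriv_add_period hx.periodic hy.periodic
        measurable_bound := measurable_plateau _ _ _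
        integrable_bound := integrable_plateau _ _ _
        le_bound := adjKernelDeriv_cross_le hx hy hD hd }
    hasDerivAt := fun α β _ => hasDerivAt_adjKernel hx (hne α β)
    exists_limit := fun β => ⟨_, ((hasDerivAt_adjKernel hx (hne β β)).continuousAt.tendsto).mono_left
      nhdsWithin_le_nhds⟩ }

end Cross

/-! ### The entries as operators from `L²` to `H¹` -/

lemma l2Norm_const_mul_le {c : ℝ} (hc : |c| ≤ 1) (f : ℝ → ℝ) :
    l2Norm (fun α => c * f α) ≤ l2Norm f := by
  refine eLpNorm_mono fun α => ?_
  rw [norm_mul]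
  exact mul_le_of_le_one_left (norm_nonneg _) hc

lemma MemL2.const_mul {f : ℝ → ℝ} (hf : MemL2 f) (c : ℝ) : MemL2 fun α => c * f α :=
  ⟨fun x => by simp only [hf.1 x], hf.2.const_mul c⟩

lemma MemL2.add {f g : ℝ → ℝ} (hf : MemL2 f) (hg : MemL2 g) : MemL2 fun α => f α + g α :=
  ⟨fun x => by simp only [hf.1 x, hg.1 x], hf.2.add hg.2⟩

lemma MemL2.integrable_mul {f φ : ℝ → ℝ} (hf : MemL2 f) (hφ : Continuous φ)
    (hφp : Function.Periodic φ (2 * π)) : Integrable (fun α => f α * φ α) circleMeasure := by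
  obtain ⟨B, hB⟩ := exists_bound_of_periodic hφ hφp
  exact hf.integrable.mul_bdd (c := B) hφ.aestronglyMeasurable (Eventually.of_forall hB)

lemma IsWeakDeriv.add {f₁ f₂ g₁ g₂ : ℝ → ℝ} (h₁ : IsWeakDeriv f₁ g₁) (h₂ : IsWeakDeriv f₂ g₂)
    (hf₁ : MemL2 f₁) (hf₂ : MemL2 f₂) (hg₁ : MemL2 g₁) (hg₂ : MemL2 g₂) :
    IsWeakDeriv (fun α => f₁ α + f₂ α) (fun α => g₁ α + g₂ α) := by
  intro φ hφ hφp
  have hφ' : Continuous (deriv φ) := hφ.continuous_deriv (by simp)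
  have hφ'p := periodic_deriv_of_periodic hφp
  simp only [add_mul]
  rw [integral_add (hf₁.integrable_mul hφ' hφ'p) (hf₂.integrable_mul hφ' hφ'p),
    integral_add (hg₁.integrable_mul hφ.continuous hφp) (hg₂.integrable_mul hφ.continuous hφp),
    h₁ φ hφ hφp, h₂ φ hφ hφp]
  ring

lemma h1Norm_le {f g : ℝ → ℝ} (hg : MemL2 g) (h : IsWeakDeriv f g) :
    h1Norm f ≤ l2Norm f + l2Norm g := by
  refine (iInf₂_le g ⟨hg, h⟩).trans ?_
  calc _ ≤ ((l2Norm f + l2Norm g) ^ 2) ^ (1 / 2 : ℝ) := by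
        refine ENNReal.rpow_le_rpow ?_ (by norm_num)
        rw [add_sq]
        gcongr
        exact le_self_add
    _ = _ := by
        rw [← ENNReal.rpow_two, ← ENNReal.rpow_mul]; norm_num

/-- `f` lies in `H¹`, and both `f` and its weak derivative are at most `B` in `L²`. -/
def H1Bound (f : ℝ → ℝ) (B : ℝ≥0∞) : Prop :=
  MemL2 f ∧ l2Norm f ≤ B ∧ ∃ g, MemL2 g ∧ IsWeakDeriv f g ∧ l2Norm g ≤ B

lemma H1Bound.add {f₁ f₂ : ℝ → ℝ} {B₁ B₂ : ℝ≥0∞} (h₁ : H1Bound f₁ B₁) (h₂ : H1Bound f₂ B₂) :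
    H1Bound (fun α => f₁ α + f₂ α) (B₁ + B₂) := by
  obtain ⟨m₁, l₁, g₁, hg₁, w₁, n₁⟩ := h₁
  obtain ⟨m₂, l₂, g₂, hg₂, w₂, n₂⟩ := h₂
  refine ⟨m₁.add m₂, ?_, fun α => g₁ α + g₂ α, hg₁.add hg₂, w₁.add w₂ m₁ m₂ hg₁ hg₂, ?_⟩
  · exact (eLpNorm_add_le m₁.2.1 m₂.2.1 (by norm_num)).trans (add_le_add l₁ l₂)
  · exact (eLpNorm_add_le hg₁.2.1 hg₂.2.1 (by norm_num)).trans (add_le_add n₁ n₂)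

lemma H1Bound.memH1 {f : ℝ → ℝ} {B : ℝ≥0∞} (h : H1Bound f B) : MemH1 f :=
  ⟨h.1, h.2.2.imp fun _ hg => ⟨hg.1, hg.2.1⟩⟩

lemma H1Bound.h1Norm_le {f : ℝ → ℝ} {B : ℝ≥0∞} (h : H1Bound f B) : h1Norm f ≤ B + B := by
  obtain ⟨_, l, g, hg, w, n⟩ := h
  exact (Muskat.h1Norm_le hg w).trans (add_le_add l n)

namespace IsSmoothingKernel

variable {x y : ℝ → ℂ} {b e k u : ℝ → ℝ}

lemma exists_hasPV
    (hK : IsSmoothingKernel (adjKernel x y) (adjKernelDeriv x y) b e k) (hu : MemL2 u) (α : ℝ) :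
    ∃ v, HasPV (adjIntegrand x y u α) α v := by
  rw [adjIntegrand_eq]; exact ⟨_, hK.hasPV hu α⟩

lemma h1Bound_adjEntry
    (hK : IsSmoothingKernel (adjKernel x y) (adjKernelDeriv x y) b e k) (hu : MemL2 u)
    {A : ℝ≥0∞} (he : ∫⁻ s, ‖e s‖ₑ ≤ A) (hk : ∫⁻ s, ‖k s‖ₑ ≤ A) :
    H1Bound (adjEntry x y u) (A * l2Norm u) := by
  have hc : |-(1 / π)| ≤ 1 := by
    rw [abs_neg, abs_of_pos (by positivity), div_le_one Real.pi_pos]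
    linarith [Real.pi_gt_three]
  have hE := hK.dominated_remainder
  have hf : adjEntry x y u = fun α => -(1 / π) * pv (fun β => adjKernel x y α β * u β) α := by
    funext α; rw [adjEntry, adjIntegrand_eq]
  have hf' : adjEntry x y u = fun α =>
      -(1 / π) * ∫ β, (adjKernel x y α β - b β * stepInv (α - β)) * u β := by
    rw [hf]; funext α; rw [hK.pv_eq hu]
  refine ⟨?_, ?_, _, (hK.dominated_deriv.memL2_integral hu).const_mul (-(1 / π)), ?_, ?_⟩
  · rw [hf']; exact (hE.memL2_integral hu).const_mul _
  · rw [hf']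
    exact (l2Norm_const_mul_le hc _).trans ((hE.l2Norm_integral_le hu).trans (by gcongr))
  · rw [hf]; exact hK.isWeakDeriv hu _
  · exact (l2Norm_const_mul_le hc _).trans
      ((hK.dominated_deriv.l2Norm_integral_le hu).trans (by gcongr))

end IsSmoothingKernel

/-- The two kernel bounds have `L¹` norms `50π M² F` and `(10/δ + 2π) M² F`; the factor `200 + 10/δ`
dominates both. -/
lemma h1Bound_adjEntry_self {δ M F : ℝ} {z : ℝ → ℂ} {u : ℝ → ℝ} (hδ : 0 < δ) (hδ1 : δ ≤ 1)
    (hz : CurveBound δ M z) (hF : ChordBound F z) (hu : MemL2 u) {Q : ℝ} (hQ : M ^ 2 * F ≤ Q) :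
    H1Bound (adjEntry z z u) (ENNReal.ofReal ((200 + 10 / δ) * Q) * l2Norm u) := by
  have hF0 := zero_le_one.trans hF.one_le
  have hpi := Real.pi_lt_d2
  have hA : 0 ≤ M ^ 2 * F := by positivity
  refine (isSmoothingKernel_self hz hF hδ hδ1).h1Bound_adjEntry hu ?_ ?_
  · rw [lintegral_plateau le_rfl le_rfl (by positivity)]
    refine ENNReal.ofReal_le_ofReal ?_
    calc 2 * 0 * 0 + 50 * (M ^ 2 * F) * π = 50 * π * (M ^ 2 * F) := by ring
      _ ≤ (200 + 10 / δ) * Q := by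
        have : 0 ≤ 10 / δ := by positivity
        gcongr
        linarith
  · rw [lintegral_self_bound hδ hA]
    refine ENNReal.ofReal_le_ofReal (mul_le_mul (by linarith) hQ hA (by positivity))

/-- The plateau has width `8 (M + N)`, which accounts for the extra powers of `M` and `N`. As these
are at least `1`, `M + N ≤ 2 M N`, and the two `L¹` norms are at most `160` and `48` times `D M²
N²`. -/
lemma h1Bound_adjEntry_cross {δ M N D : ℝ} {x y : ℝ → ℂ} {u : ℝ → ℝ} (hδ : 0 < δ)
    (hx : CurveBound δ M x) (hy : CurveBound δ N y) (hD : 1 ≤ D)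
    (hd : ∀ α β, 1 ≤ D * ‖x α - y β‖ ^ 2) (hu : MemL2 u) {Q : ℝ}
    (hQ : D * M ^ 2 * N ^ 2 ≤ Q) :
    H1Bound (adjEntry x y u) (ENNReal.ofReal ((200 + 10 / δ) * Q) * l2Norm u) := by
  have hpi := Real.pi_lt_d2
  have hpi0 := Real.pi_pos
  have hM := hx.one_le
  have hN := hy.one_le
  have hMN : M + N ≤ 2 * (M * N) := by nlinarith
  have h1 : M * N ≤ D * M ^ 2 * N ^ 2 := by
    have : 1 ≤ D * (M * N) := one_le_mul_of_one_le_of_one_le hD (one_le_mul_of_one_le_of_one_le hM hN)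
    calc M * N = 1 * (M * N) := by ring
      _ ≤ D * (M * N) * (M * N) := by gcongr
      _ = _ := by ring
  have h2 : N * (M + N) ≤ 2 * (M ^ 2 * N ^ 2) := by
    calc N * (M + N) ≤ N * (2 * (M * N)) := by gcongr
      _ = 2 * (1 * M * N ^ 2) := by ring
      _ ≤ 2 * (M * M * N ^ 2) := by gcongr
      _ = _ := by ring
  have h2' : N * (M + N) ≤ 2 * (D * M ^ 2 * N ^ 2) := by
    calc _ ≤ 1 * (2 * (M ^ 2 * N ^ 2)) := by rw [one_mul]; exact h2
      _ ≤ D * (2 * (M ^ 2 * N ^ 2)) := by gcongr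
      _ = _ := by ring
  have h3 : N * D * (M + N) ≤ 2 * (D * M ^ 2 * N ^ 2) := by
    calc N * D * (M + N) = D * (N * (M + N)) := by ring
      _ ≤ D * (2 * (M ^ 2 * N ^ 2)) := by gcongr
      _ = _ := by ring
  have h4 : M * N * D * (M + N) ≤ 2 * (D * M ^ 2 * N ^ 2) := by
    calc M * N * D * (M + N) ≤ M * N * D * (2 * (M * N)) := by gcongr
      _ = _ := by ring
  have hq : 0 ≤ D * M ^ 2 * N ^ 2 := by positivity
  have hC : (200 + 10 / δ) * (D * M ^ 2 * N ^ 2) ≤ (200 + 10 / δ) * Q := by gcongr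
  have hC' : 200 * (D * M ^ 2 * N ^ 2) ≤ (200 + 10 / δ) * (D * M ^ 2 * N ^ 2) := by
    gcongr
    have : 0 ≤ 10 / δ := by positivity
    linarith
  refine (isSmoothingKernel_cross hx hy hD hd).h1Bound_adjEntry hu ?_ ?_
  · rw [lintegral_plateau (by positivity) (by positivity) (by positivity)]
    refine ENNReal.ofReal_le_ofReal ?_
    have : 16 * (N * (M + N)) * π ≤ 16 * (N * (M + N)) * 4 := by gcongr; linarith
    nlinarith
  · rw [lintegral_plateau (by positivity) (by positivity) (by positivity)]
    refine ENNReal.ofReal_le_ofReal ?_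
    have : 8 * (M * N) * π ≤ 8 * (M * N) * 4 := by gcongr; linarith
    nlinarith

end Muskat

end

/-! ### The matrix operator: summing the four entries -/

theorem mainTheorem6 (δ : ℝ) (hδ : 0 < δ) (hδ1 : δ ≤ 1) :
    ∃ C : ℝ≥0, ∀ z h : ℝ → ℂ,
      Muskat.IsPeriodicCurve z → Muskat.IsPeriodicCurve h →
      Muskat.IsC2Holder δ z → Muskat.IsC2Holder δ h →
      Muskat.arcChordNorm z < ⊤ → Muskat.arcChordNorm h < ⊤ → Muskat.distNorm z h < ⊤ →
      ∀ u₁ u₂ : ℝ → ℝ, Muskat.MemL2 u₁ → Muskat.MemL2 u₂ →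
        (∀ α : ℝ,
          (∃ v, Muskat.HasPV (Muskat.adjIntegrand z z u₁ α) α v) ∧
          (∃ v, Muskat.HasPV (Muskat.adjIntegrand h z u₁ α) α v) ∧
          (∃ v, Muskat.HasPV (Muskat.adjIntegrand z h u₂ α) α v) ∧
          (∃ v, Muskat.HasPV (Muskat.adjIntegrand h h u₂ α) α v)) ∧
        Muskat.MemH1 (Muskat.adjFst z h u₁ u₂) ∧
        Muskat.MemH1 (Muskat.adjSnd z h u₁ u₂) ∧
        Muskat.h1Norm (Muskat.adjFst z h u₁ u₂) + Muskat.h1Norm (Muskat.adjSnd z h u₁ u₂) ≤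
          (C * Muskat.arcChordNorm h ^ 2 * Muskat.holderNorm δ h ^ 2) *
            (Muskat.arcChordNorm z ^ 2 * (max 1 (Muskat.distNorm z h)) ^ 2 *
              Muskat.holderNorm δ z ^ 2) *
            (Muskat.l2Norm u₁ + Muskat.l2Norm u₂) := by
  -- A factor `2` comes from adding the bounds for a function and its derivative, another from each
  -- `uᵢ` entering both components.
  refine ⟨(4 * (200 + 10 / δ)).toNNReal, fun z h pz ph cz ch fz fh hd u₁ u₂ hu₁ hu₂ => ?_⟩
  have bz := Muskat.curveBound_of_isC2Holder pz cz hδ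
  have bh := Muskat.curveBound_of_isC2Holder ph ch hδ
  have az := Muskat.chordBound_of_arcChordNorm pz fz
  have ah := Muskat.chordBound_of_arcChordNorm ph fh
  have dzh := Muskat.dist_bound hd
  have dhz : ∀ α β, 1 ≤ (max 1 (Muskat.distNorm z h)).toReal * ‖h α - z β‖ ^ 2 := fun α β => by
    rw [norm_sub_rev]; exact dzh β α
  have htop : max 1 (Muskat.distNorm z h) ≠ ⊤ := (max_lt ENNReal.one_lt_top hd).ne
  have hD : 1 ≤ (max 1 (Muskat.distNorm z h)).toReal := by
    rw [← ENNReal.toReal_one]; exact ENNReal.toReal_mono htop (le_max_left _ _)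
  rw [← ENNReal.ofReal_toReal fz.ne, ← ENNReal.ofReal_toReal fh.ne, ← ENNReal.ofReal_toReal htop,
    ← ENNReal.ofReal_toReal cz.2.ne, ← ENNReal.ofReal_toReal ch.2.ne]
  set M := (Muskat.holderNorm δ z).toReal
  set N := (Muskat.holderNorm δ h).toReal
  set F := (Muskat.arcChordNorm z).toReal
  set G := (Muskat.arcChordNorm h).toReal
  set D := (max 1 (Muskat.distNorm z h)).toReal
  have hM := bz.one_le
  have hN := bh.one_le
  have hF := az.one_le
  have hG := ah.one_le
  set Q := G ^ 2 * N ^ 2 * (F ^ 2 * D ^ 2 * M ^ 2) with hQ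
  have sq1 : ∀ {t : ℝ}, 1 ≤ t → 1 ≤ t ^ 2 := fun ht => one_le_pow₀ ht
  have sq2 : ∀ {t : ℝ}, 1 ≤ t → t ≤ t ^ 2 := fun ht => le_self_pow₀ ht two_ne_zero
  -- All five quantities are at least `1`, so factors missing from an entry's own constant are
  -- filled in by ones.
  have q1 : M ^ 2 * F ≤ Q := by
    calc M ^ 2 * F = 1 * 1 * (F * 1 * M ^ 2) := by ring
      _ ≤ Q := by
        rw [hQ]; gcongr
        exacts [sq1 hG, sq1 hN, sq2 hF, sq1 hD]
  have q2 : N ^ 2 * G ≤ Q := by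
    calc N ^ 2 * G = G * N ^ 2 * (1 * 1 * 1) := by ring
      _ ≤ Q := by
        rw [hQ]; gcongr
        exacts [sq2 hG, sq1 hF, sq1 hD, sq1 hM]
  have q3 : D * M ^ 2 * N ^ 2 ≤ Q := by
    calc D * M ^ 2 * N ^ 2 = 1 * N ^ 2 * (1 * D * M ^ 2) := by ring
      _ ≤ Q := by
        rw [hQ]; gcongr
        exacts [sq1 hG, sq1 hF, sq2 hD]
  have q4 : D * N ^ 2 * M ^ 2 ≤ Q := by linarith
  have e1 := Muskat.h1Bound_adjEntry_self hδ hδ1 bz az hu₁ q1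
  have e2 := Muskat.h1Bound_adjEntry_cross hδ bh bz hD dhz hu₁ q4
  have e3 := Muskat.h1Bound_adjEntry_cross hδ bz bh hD dzh hu₂ q3
  have e4 := Muskat.h1Bound_adjEntry_self hδ hδ1 bh ah hu₂ q2
  have k13 := e1.add e3
  have k24 := e2.add e4
  refine ⟨fun α => ⟨?_, ?_, ?_, ?_⟩, k13.memH1, k24.memH1, ?_⟩
  · exact (Muskat.isSmoothingKernel_self bz az hδ hδ1).exists_hasPV hu₁ α
  · exact (Muskat.isSmoothingKernel_cross bh bz hD dhz).exists_hasPV hu₁ α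
  · exact (Muskat.isSmoothingKernel_cross bz bh hD dzh).exists_hasPV hu₂ α
  · exact (Muskat.isSmoothingKernel_self bh ah hδ hδ1).exists_hasPV hu₂ α
  have hC : (0 : ℝ) ≤ 4 * (200 + 10 / δ) := by positivity
  have hcoef : (((4 * (200 + 10 / δ)).toNNReal : ℝ≥0∞) * ENNReal.ofReal G ^ 2 *
      ENNReal.ofReal N ^ 2) * (ENNReal.ofReal F ^ 2 * ENNReal.ofReal D ^ 2 *
      ENNReal.ofReal M ^ 2) = 4 * ENNReal.ofReal ((200 + 10 / δ) * Q) := by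
    rw [show ((4 * (200 + 10 / δ)).toNNReal : ℝ≥0∞) = ENNReal.ofReal (4 * (200 + 10 / δ)) from rfl,
      show (4 : ℝ≥0∞) = ENNReal.ofReal 4 by simp]
    simp only [← ENNReal.ofReal_pow (zero_le_one.trans hG), ← ENNReal.ofReal_pow
      (zero_le_one.trans hN), ← ENNReal.ofReal_pow (zero_le_one.trans hF), ← ENNReal.ofReal_pow
      (zero_le_one.trans hD), ← ENNReal.ofReal_pow (zero_le_one.trans hM)]
    rw [← ENNReal.ofReal_mul (by positivity), ← ENNReal.ofReal_mul (by positivity),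
      ← ENNReal.ofReal_mul (by positivity), ← ENNReal.ofReal_mul (by positivity),
      ← ENNReal.ofReal_mul (by positivity), ← ENNReal.ofReal_mul (by positivity)]
    congr 1
    rw [hQ]; ring
  rw [hcoef]
  refine (add_le_add k13.h1Norm_le k24.h1Norm_le).trans_eq ?_
  ring
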